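/- **Setting.** Let $v_{40},v_{22},v_{04},v_{60},v_{42},v_{24},v_{06}\in\mathbb R$ and put $A=\tfrac38(v_{40}+v_{04})$, $B=\tfrac34(v_{40}-v_{04})$, $C=\tfrac18v_{22}$. For a detuning $\delta$ let $K=K_0+K_2+K_4$ be the detuned Birkhoff normal form (up to degree six) of the 2:2 resonance with quartic and sextic potential $\sum v_{ij}x_1^ix_2^j$: with $c=\cos(2\phi_1-2\phi_2)$, $$K_0=J_1+J_2,\qquad K_2=\delta J_1+\tfrac32v_{40}J_1^2+\tfrac32v_{04}J_2^2+\tfrac12v_{22}J_1J_2(2+c),$$ $$\begin{aligned}K_4={}&-\delta\left[3v_{40}J_1^2+\tfrac12v_{22}J_1J_2(2+c)\right]+\tfrac14(10v_{60}-17v_{40}^2)J_1^3+\tfrac14(10v_{06}-17v_{04}^2)J_2^3\\&+\tfrac14J_1^2J_2\left[6v_{42}-\tfrac94v_{22}^2-12v_{22}v_{40}+(4v_{42}-2v_{22}^2-5v_{22}v_{40})c\right]\\&+\tfrac14J_1J_2^2\left[6v_{24}-\tfrac94v_{22}^2-12v_{22}v_{04}+(4v_{24}-2v_{22}^2-5v_{22}v_{04})c\right].\end{aligned}$$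 For $\mathcal E>0$ set $J_1=J$, $J_2=\mathcal E-J$, $\psi=\phi_1-\phi_2$. This gives a one-degree-of-freedom Hamiltonian system in $(J,\psi)$, $0<J<\mathcal E$, whose phase space is closed up to a sphere by the two normal modes: mode 1 ($J=0$) and mode 2 ($J=\mathcal E$), around which $\sqrt{2J}\,e^{i\psi}$, respectively $\sqrt{2(\mathcal E-J)}\,e^{i\psi}$, are coordinates. Other fixed points are *inclined* ($I$) if $\psi\in\{0,\pi\}$, and *loop* ($L$) if $\psi=\pm\pi/2$. A fixed point is *stable* (resp. a *saddle*) if the Hessian of the Hamiltonian there has positive (resp. negative) determinant. For fixed $\delta$ and growing $\mathcal E$, the bifurcation $(kF)$, $k\in\{1,2\}$, $F\in\{I,L\}$, at $\mathcal E=e$ means: on one side of $e$ there are no fixed points of family $F$ and mode $k$ is stable; on the other side family $F$ consists of exactly one symmetric pair of fixed points, both stable, mode $k$ is a saddle, and the pair tends to mode $k$ as $\mathcal E\to e$. If the pair exists for $\mathcal E>e$ it *appears* (pitchfork), if for $\mathcal E<e$ it *disappears* (anti-pitchfork). The *global bifurcation* $(GB)$ at $e$ means: both modes are saddles, they are joined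 in both directions by heteroclinic orbits at $\mathcal E=e$ but for no other $\mathcal E$ near $e$, while number and nature of the fixed points do not change near $e$. A value $\mathcal E$ is *regular* if the number and nature of the fixed points are constant near $\mathcal E$ and the two modes are not joined by a heteroclinic orbit. **Proposition.** Assume $C\ne0$ and $A-3C<0<A-C$. There are functions $\mathcal E_{1I},\mathcal E_{1L},\mathcal E_{2I},\mathcal E_{2L},\mathcal E_{GB}$ of $\delta$ and constants $r,\delta_0>0$, depending only on the coefficients $v_{ij}$, such that, as $\delta\to0$, $\delta\le 0$, $$\mathcal E_{1I}=\tfrac{\delta}{2(2A-B-6C)}+\tfrac{(136A^2+34B^2+280BC+456C^2-8A(17B+70C)+15v_{24}-45v_{06})\,\delta^2}{48(2A-B-6C)^3}+O(\delta^3)\quad\text{if } B>2(A-3C),$$ $$\mathcal E_{1L}=\tfrac{\delta}{2(2A-B-2C)}+\tfrac{(136A^2+34B^2+104BC+72C^2-8A(17B+26C)+3v_{24}-45v_{06})\,\delta^2}{48(2A-B-2C)^3}+O(\delta^3)\quad\text{if } B>2(A-C),$$ $$\mathcal E_{2I}=-\tfrac{\delta}{2(2A+B-6C)}-\tfrac{(56A^2+14B^2+8A(7B-74C)-296BC+1272C^2+45v_{60}-15v_{42})\,\delta^2}{48(2A+B-6C)^3}+O(\delta^3)\quad\text{if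 } B>2(3C-A),$$ $$\mathcal E_{2L}=-\tfrac{\delta}{2(2A+B-2C)}-\tfrac{(56A^2+14B^2+8A(7B-22C)-88BC+120C^2+45v_{60}-3v_{42})\,\delta^2}{48(2A+B-2C)^3}+O(\delta^3)\quad\text{if } B>2(C-A),$$ $$\mathcal E_{GB}=-\tfrac{\delta}{2B}+O(\delta^2)\quad\text{if } B>0,$$ and the following holds for all $\delta\in(-\delta_0,0)$. Each threshold whose condition on $B$ (as just displayed) holds lies in $(0,r)$, and the corresponding bifurcation takes place there: $(1I)$ and $(2L)$ are pitchforks (a pair appears), $(1L)$ and $(2I)$ are anti-pitchforks (the pair disappears), $(GB)$ is a global bifurcation. * If $A-2C<0$, those thresholds whose conditions hold are strictly increasing in the order $(1I)-(2L)-(GB)-(1L)-(2I)$. * If $0<A-2C$, they are strictly increasing in the order $(2L)-(1I)-(GB)-(2I)-(1L)$. If all the conditions on $B$ hold, this is in both cases the full bifurcation sequence: every other $\mathcal E\in(0,r)$ is regular. For $\delta=0$, under all the conditions on $B$, every $\mathcal E\in(0,r)$ is regular (all thresholds have collapsed to $\mathcal E=0$). -/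

import Mathlib

open Set Filter Topology Asymptotics

namespace Resonance22

/-- The coefficients of the potential
`v40 x₁⁴ + v22 x₁² x₂² + v04 x₂⁴ + v60 x₁⁶ + v42 x₁⁴ x₂² + v24 x₁² x₂⁴ + v06 x₂⁶`. -/
structure Coeffs where
  (v40 v22 v04 v60 v42 v24 v06 : ℝ)

noncomputable section

namespace Coeffs

variable (v : Coeffs)

def A : ℝ := 3 / 8 * (v.v40 + v.v04)

def B : ℝ := 3 / 4 * (v.v40 - v.v04)

def C : ℝ := 1 / 8 * v.v22

end Coeffs

/-! ### The normal form and the reduced systems -/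

/-- The detuned Birkhoff normal form `K₀ + K₂ + K₄` of the 2:2 resonance (terms up to degree six
in the original variables), as a function of the actions `J₁`, `J₂` and of
`w = J₁ J₂ cos (2φ₁ - 2φ₂)`. -/
def normalForm (v : Coeffs) (δ J₁ J₂ w : ℝ) : ℝ :=
  (J₁ + J₂)
  + (δ * J₁ + 3 / 2 * v.v40 * J₁ ^ 2 + 3 / 2 * v.v04 * J₂ ^ 2
      + 1 / 2 * v.v22 * (2 * (J₁ * J₂) + w))
  + (-δ * (3 * v.v40 * J₁ ^ 2 + 1 / 2 * v.v22 * (2 * (J₁ * J₂) + w))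
      + 1 / 4 * (10 * v.v60 - 17 * v.v40 ^ 2) * J₁ ^ 3
      + 1 / 4 * (10 * v.v06 - 17 * v.v04 ^ 2) * J₂ ^ 3
      + 1 / 4 * J₁ * ((6 * v.v42 - 9 / 4 * v.v22 ^ 2 - 12 * v.v22 * v.v40) * (J₁ * J₂)
          + (4 * v.v42 - 2 * v.v22 ^ 2 - 5 * v.v22 * v.v40) * w)
      + 1 / 4 * J₂ * ((6 * v.v24 - 9 / 4 * v.v22 ^ 2 - 12 * v.v22 * v.v04) * (J₁ * J₂)
          + (4 * v.v24 - 2 * v.v22 ^ 2 - 5 * v.v22 * v.v04) * w))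

/-- The 1DOF Hamiltonian: `J₁ = J`, `J₂ = E - J`, `ψ = φ₁ - φ₂`, where `E` is the distinguished
parameter. Its phase space is the annulus `0 < J < E`, `ψ` mod `2π`, closed up to a sphere by the
two normal modes `J = 0` and `J = E`. -/
def effHam (v : Coeffs) (δ E J ψ : ℝ) : ℝ :=
  normalForm v δ J (E - J) (J * (E - J) * Real.cos (2 * ψ))

/-- The two normal modes: `one` is `J₁ = 0`, `two` is `J₂ = 0`. -/
inductive Mode
  | one
  | two

/-- The value of `J` at a normal mode. -/
def Mode.action (E : ℝ) : Mode → ℝ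
  | .one => 0
  | .two => E

/-- The 1DOF Hamiltonian in the Cartesian chart of the sphere centred at a normal mode:
`z = √(2J) (cos ψ, sin ψ)` around mode `one`, `z = √(2(E - J)) (cos ψ, sin ψ)` around mode `two`,
on the disc `|z|² < 2E`. The origin is the normal mode. -/
def planarHam (v : Coeffs) (δ E : ℝ) : Mode → ℝ × ℝ → ℝ
  | .one, z => normalForm v δ ((z.1 ^ 2 + z.2 ^ 2) / 2) (E - (z.1 ^ 2 + z.2 ^ 2) / 2)
      ((z.1 ^ 2 - z.2 ^ 2) / 2 * (E - (z.1 ^ 2 + z.2 ^ 2) / 2))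
  | .two, z => normalForm v δ (E - (z.1 ^ 2 + z.2 ^ 2) / 2) ((z.1 ^ 2 + z.2 ^ 2) / 2)
      ((z.1 ^ 2 - z.2 ^ 2) / 2 * (E - (z.1 ^ 2 + z.2 ^ 2) / 2))

theorem planarHam_one (v : Coeffs) (δ E J ψ : ℝ) (hJ : 0 ≤ J) :
    planarHam v δ E .one (√(2 * J) * Real.cos ψ, √(2 * J) * Real.sin ψ) = effHam v δ E J ψ := by
  have h : √(2 * J) ^ 2 = 2 * J := Real.sq_sqrt (by linarith)
  have hs : Real.sin ψ ^ 2 = 1 - Real.cos ψ ^ 2 := Real.sin_sq ψ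
  simp only [planarHam, effHam, mul_pow, h, hs, Real.cos_two_mul]
  congr 1 <;> ring

theorem planarHam_two (v : Coeffs) (δ E J ψ : ℝ) (hJ : J ≤ E) :
    planarHam v δ E .two (√(2 * (E - J)) * Real.cos ψ, √(2 * (E - J)) * Real.sin ψ)
      = effHam v δ E J ψ := by
  have h : √(2 * (E - J)) ^ 2 = 2 * (E - J) := Real.sq_sqrt (by linarith)
  have hs : Real.sin ψ ^ 2 = 1 - Real.cos ψ ^ 2 := Real.sin_sq ψ
  simp only [planarHam, effHam, mul_pow, h, hs, Real.cos_two_mul]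
  congr 1 <;> ring

/-! ### Fixed points of planar Hamiltonian systems -/

/-- Partial derivative in the first variable. -/
def dX (H : ℝ × ℝ → ℝ) (z : ℝ × ℝ) : ℝ := deriv (fun t => H (t, z.2)) z.1

/-- Partial derivative in the second variable. -/
def dY (H : ℝ × ℝ → ℝ) (z : ℝ × ℝ) : ℝ := deriv (fun t => H (z.1, t)) z.2

/-- Fixed points of the Hamiltonian vector field `(∂H/∂y, -∂H/∂x)`. -/
def IsFixedPoint (H : ℝ × ℝ → ℝ) (z : ℝ × ℝ) : Prop := dX H z = 0 ∧ dY H z = 0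

/-- The determinant of the Hessian of `H`, which is the determinant of the (trace-free)
linearization of the Hamiltonian vector field. -/
def hessDet (H : ℝ × ℝ → ℝ) (z : ℝ × ℝ) : ℝ :=
  dX (dX H) z * dY (dY H) z - dX (dY H) z * dY (dX H) z

/-- A stable fixed point: the linearization has eigenvalues `± i ω`, `ω > 0`; equivalently `z` is
a nondegenerate local extremum of the conserved quantity `H`. -/
def IsStable (H : ℝ × ℝ → ℝ) (z : ℝ × ℝ) : Prop := IsFixedPoint H z ∧ 0 < hessDet H z

/-- An unstable fixed point (saddle): the linearization has eigenvalues `± λ`, `λ > 0`. -/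
def IsSaddle (H : ℝ × ℝ → ℝ) (z : ℝ × ℝ) : Prop := IsFixedPoint H z ∧ hessDet H z < 0

/-! ### The families of fixed points in general position -/

/-- Inclined orbits: `ψ = 0, π`. Loop orbits: `ψ = ± π / 2`. -/
inductive Family
  | inclined
  | loop

/-- The point at signed distance `s` from the origin on the axis of a family, in either chart. -/
def Family.point : Family → ℝ → ℝ × ℝ
  | .inclined, s => (s, 0)
  | .loop, s => (0, s)

/-- The fixed points of the 1DOF system other than the normal modes, in the chart at mode `k`. -/
def fixedPoints (v : Coeffs) (δ E : ℝ) (k : Mode) : Set (ℝ × ℝ) :=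
  {z | 0 < z.1 ^ 2 + z.2 ^ 2 ∧ z.1 ^ 2 + z.2 ^ 2 < 2 * E ∧ IsFixedPoint (planarHam v δ E k) z}

/-- The fixed points in general position that belong to the family `F`, in the chart at `k`. -/
def familyPoints (v : Coeffs) (δ E : ℝ) (k : Mode) (F : Family) : Set (ℝ × ℝ) :=
  fixedPoints v δ E k ∩ range F.point

/-- The normal mode `k` is stable. -/
def ModeStable (v : Coeffs) (δ E : ℝ) (k : Mode) : Prop := IsStable (planarHam v δ E k) (0, 0)

/-- The normal mode `k` is a saddle. -/
def ModeSaddle (v : Coeffs) (δ E : ℝ) (k : Mode) : Prop := IsSaddle (planarHam v δ E k) (0, 0)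

/-- There is a heteroclinic orbit of the 1DOF system from the normal mode `k` to the normal mode
`l`: a solution of Hamilton's equations in the annulus, defined for all times, that tends to `k`
in the past and to `l` in the future. (`ψ` is a lift of the angle to `ℝ`; in the coordinates
`x = √(2J) cos φ`, `p = √(2J) sin φ` the equations read `J' = ∂K/∂ψ`, `ψ' = -∂K/∂J`.) -/
def HasConnection (v : Coeffs) (δ E : ℝ) (k l : Mode) : Prop :=
  ∃ J ψ : ℝ → ℝ,
    (∀ t, 0 < J t ∧ J t < E) ∧
    (∀ t, HasDerivAt J (deriv (fun θ => effHam v δ E (J t) θ) (ψ t)) t) ∧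
    (∀ t, HasDerivAt ψ (-deriv (fun I => effHam v δ E I (ψ t)) (J t)) t) ∧
    Tendsto J atBot (𝓝 (k.action E)) ∧ Tendsto J atTop (𝓝 (l.action E))

/-! ### Bifurcations, as the distinguished parameter `E` varies at fixed detuning -/

/-- The phase portraits at `E` and `E'` have the same number of fixed points of each family and
of each nature, and normal modes of the same nature. -/
def SameNature (v : Coeffs) (δ E E' : ℝ) : Prop :=
  (fixedPoints v δ E .one).encard = (fixedPoints v δ E' .one).encard ∧
  (∀ F : Family,
    (familyPoints v δ E .one F).encard = (familyPoints v δ E' .one F).encard ∧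
    (familyPoints v δ E .one F ∩ {z | IsStable (planarHam v δ E .one) z}).encard
      = (familyPoints v δ E' .one F ∩ {z | IsStable (planarHam v δ E' .one) z}).encard ∧
    (familyPoints v δ E .one F ∩ {z | IsSaddle (planarHam v δ E .one) z}).encard
      = (familyPoints v δ E' .one F ∩ {z | IsSaddle (planarHam v δ E' .one) z}).encard) ∧
  ∀ k : Mode, (ModeStable v δ E k ↔ ModeStable v δ E' k) ∧
    (ModeSaddle v δ E k ↔ ModeSaddle v δ E' k)

/-- No bifurcation takes place at `E`: number and nature of the fixed points are locally constant
and the normal modes are not connected by a heteroclinic orbit. -/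
def IsRegularEnergy (v : Coeffs) (δ E : ℝ) : Prop :=
  (∀ᶠ E' in 𝓝 E, SameNature v δ E E') ∧
    ¬ HasConnection v δ E .one .two ∧ ¬ HasConnection v δ E .two .one

/-- A pair of stable fixed points of the family `F` branches off the normal mode `k`. On the side
`without` there is no fixed point of the family and the mode is stable; on the side `present` the
family consists of exactly two, symmetric, fixed points, both stable, the mode is a saddle, and
the pair tends to the mode. -/
def StablePairBranches (v : Coeffs) (δ : ℝ) (k : Mode) (F : Family)
    (without present : Filter ℝ) : Prop :=
  (∀ᶠ E in without, familyPoints v δ E k F = ∅ ∧ ModeStable v δ E k) ∧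
  ∃ s : ℝ → ℝ, Tendsto s present (𝓝 0) ∧
    ∀ᶠ E in present, 0 < s E ∧
      familyPoints v δ E k F = {F.point (s E), F.point (-s E)} ∧
      IsStable (planarHam v δ E k) (F.point (s E)) ∧
      IsStable (planarHam v δ E k) (F.point (-s E)) ∧
      ModeSaddle v δ E k

/-- `appears k F`: pitchfork, a pair of stable fixed points of family `F` originates from mode `k`
as `E` increases. `disappears k F`: anti-pitchfork, the pair annihilates at mode `k` as `E`
increases. `connection`: global bifurcation. -/
inductive Bifurcation
  | appears (k : Mode) (F : Family)
  | disappears (k : Mode) (F : Family)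
  | connection

/-- The given bifurcation takes place at the value `e` of the distinguished parameter. The global
one: both normal modes are saddles, they are joined in both directions by heteroclinic orbits at
`e` and at no other nearby value, while number and nature of the fixed points do not change. -/
def OccursAt (v : Coeffs) (δ e : ℝ) : Bifurcation → Prop
  | .appears k F => StablePairBranches v δ k F (𝓝[<] e) (𝓝[>] e)
  | .disappears k F => StablePairBranches v δ k F (𝓝[>] e) (𝓝[<] e)
  | .connection =>
      ModeSaddle v δ e .one ∧ ModeSaddle v δ e .two ∧
      HasConnection v δ e .one .two ∧ HasConnection v δ e .two .one ∧
      (∀ᶠ E in 𝓝 e, SameNature v δ e E) ∧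
      ∀ᶠ E in 𝓝[≠] e, ¬ HasConnection v δ E .one .two ∧ ¬ HasConnection v δ E .two .one

/-- A bifurcation, the value of the distinguished parameter where it is to take place, and the
condition on the coefficients under which this value is positive. -/
structure Threshold where
  cond : Prop
  energy : ℝ
  kind : Bifurcation

/-- `l` is the bifurcation sequence for `0 < E < r`: each bifurcation whose condition holds takes
place at its threshold, in the order of the list; and if all conditions hold, then no further
bifurcation takes place. -/
def IsBifurcationSequence (v : Coeffs) (δ r : ℝ) (l : List Threshold) : Prop :=
  (∀ t ∈ l, t.cond → 0 < t.energy ∧ t.energy < r ∧ OccursAt v δ t.energy t.kind) ∧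
  l.Pairwise (fun s t => s.cond → t.cond → s.energy < t.energy) ∧
  ((∀ t ∈ l, t.cond) → ∀ E, 0 < E → E < r → IsRegularEnergy v δ E ∨ ∃ t ∈ l, E = t.energy)

/-! ### The second order expansions of the thresholds -/

def expansion1I (v : Coeffs) (δ : ℝ) : ℝ :=
  δ / (2 * (2 * v.A - v.B - 6 * v.C))
  + (136 * v.A ^ 2 + 34 * v.B ^ 2 + 280 * v.B * v.C + 456 * v.C ^ 2
      - 8 * v.A * (17 * v.B + 70 * v.C) + 15 * v.v24 - 45 * v.v06) * δ ^ 2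
    / (48 * (2 * v.A - v.B - 6 * v.C) ^ 3)

def expansion1L (v : Coeffs) (δ : ℝ) : ℝ :=
  δ / (2 * (2 * v.A - v.B - 2 * v.C))
  + (136 * v.A ^ 2 + 34 * v.B ^ 2 + 104 * v.B * v.C + 72 * v.C ^ 2
      - 8 * v.A * (17 * v.B + 26 * v.C) + 3 * v.v24 - 45 * v.v06) * δ ^ 2
    / (48 * (2 * v.A - v.B - 2 * v.C) ^ 3)

def expansion2I (v : Coeffs) (δ : ℝ) : ℝ :=
  -(δ / (2 * (2 * v.A + v.B - 6 * v.C)))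
  - (56 * v.A ^ 2 + 14 * v.B ^ 2 + 8 * v.A * (7 * v.B - 74 * v.C) - 296 * v.B * v.C
      + 1272 * v.C ^ 2 + 45 * v.v60 - 15 * v.v42) * δ ^ 2
    / (48 * (2 * v.A + v.B - 6 * v.C) ^ 3)

def expansion2L (v : Coeffs) (δ : ℝ) : ℝ :=
  -(δ / (2 * (2 * v.A + v.B - 2 * v.C)))
  - (56 * v.A ^ 2 + 14 * v.B ^ 2 + 8 * v.A * (7 * v.B - 22 * v.C) - 88 * v.B * v.C
      + 120 * v.C ^ 2 + 45 * v.v60 - 3 * v.v42) * δ ^ 2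
    / (48 * (2 * v.A + v.B - 2 * v.C) ^ 3)

end

end Resonance22

open Resonance22

/-!
In the chart at a normal mode put `p = (x² + y²) / 2` and `q = (x² - y²) / 2`. The Hamiltonian is
`P(p) + q (E - p) Q(p)` with `P` a cubic and `Q` an affine polynomial, and `Q > 0` for small `E`
and `δ`, since `Q ≈ 4C` and the hypotheses force `C > 0`. Hence all fixed points other than the
modes lie on the two axes, that is, they are inclined or loop orbits (`Chart.isFixedPoint_iff`).

On the axis of a family the Hamiltonian is a cubic polynomial `h(p)`. Because of
`A - 3C < 0 < A - C` it is strictly concave for the inclined and strictly convex for the loop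
family, so that `± h'` (`Chart.slope`) is strictly decreasing. A family is therefore empty or one
symmetric pair, which is always stable, and it is a pair exactly when the slopes of the family at
both modes, each taken in the chart of that mode (`modeSlope`), are positive
(`exists_pair`, `familyPoints_eq_empty`). The two slopes at one mode are up to sign the eigenvalues
of the Hessian there, so the mode is a saddle if both are positive and stable if one is negative;
both cannot be negative, as their sum is `2 E Q(0)`. The four signs thus determine the phase
portrait, and a pair branches off a mode whenever one of its slopes passes through zero
(`stablePairBranches_of_modeSlope`).

Energy conservation shows that a heteroclinic orbit needs the modes to lie on the same level
(`HasConnection.gap_eq_zero`). Conversely, if they do and both are saddles, then the level set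
contains the curve `cos 2ψ = R(J) / Q(J)` with `R` affine and `|R| < Q` on `[0, E]`, and the motion
along it is a connecting orbit (`hasConnection_of_gap_eq_zero`).

The four slopes and the difference of the two levels, divided by `E`, are up to sign all of the form
`δ + E (a + b δ + d E)` (`Curve`). For `a > 0` such a function has a unique small root `E` for
`δ < 0`, with an explicit second order expansion (`Curve.exists_root`), and the root is the smaller,
the larger `a` is (`Regime.root_lt_root`). The conditions on `B` say `a > 0`, and comparing the
numbers `a` gives the order of the thresholds.
-/

namespace Resonance22

noncomputable section

/-! ### Planar Hamiltonians in a chart centred at a normal mode -/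

/-- The sign `cos 2ψ` takes on a family: `1` on inclined orbits, `-1` on loop orbits. -/
def Family.sign : Family → ℝ
  | .inclined => 1
  | .loop => -1

/-- The family whose axis is perpendicular. -/
def Family.other : Family → Family
  | .inclined => .loop
  | .loop => .inclined

/-- The data of the Hamiltonian `c0 + c1 p + c2 p² + c3 p³ + q (E - p) (d0 + d1 p)` of a chart,
where `p = (x² + y²) / 2` and `q = (x² - y²) / 2`. -/
structure Chart where
  (c0 c1 c2 c3 d0 d1 E : ℝ)

namespace Chart

variable (c : Chart)

/-- The Hamiltonian with the data `c`. -/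
def ham (z : ℝ × ℝ) : ℝ :=
  c.c0 + c.c1 * ((z.1 ^ 2 + z.2 ^ 2) / 2) + c.c2 * ((z.1 ^ 2 + z.2 ^ 2) / 2) ^ 2
    + c.c3 * ((z.1 ^ 2 + z.2 ^ 2) / 2) ^ 3
    + (z.1 ^ 2 - z.2 ^ 2) / 2 * ((c.E - (z.1 ^ 2 + z.2 ^ 2) / 2)
      * (c.d0 + c.d1 * ((z.1 ^ 2 + z.2 ^ 2) / 2)))

/-- The coefficient `(E - p) (d0 + d1 p)` of `q` in the Hamiltonian. -/
def amp (p : ℝ) : ℝ := (c.E - p) * (c.d0 + c.d1 * p)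

/-- The derivative of `amp`. -/
def amp' (p : ℝ) : ℝ := c.d1 * c.E - c.d0 - 2 * c.d1 * p

/-- The derivative with respect to `p`, at constant `q`. -/
def dP (p q : ℝ) : ℝ := c.c1 + 2 * c.c2 * p + 3 * c.c3 * p ^ 2 + q * c.amp' p

/-- The second derivative with respect to `p`, at constant `q`. -/
def dPP (p q : ℝ) : ℝ := 2 * c.c2 + 6 * c.c3 * p - 2 * c.d1 * q

/-- On the axis of the family `F` the Hamiltonian is a cubic polynomial `h` in `p`; this is
`± h'`, with the sign `+` for inclined and `-` for loop orbits. -/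
def slope (F : Family) (p : ℝ) : ℝ :=
  F.sign * (c.c1 + 2 * c.c2 * p + 3 * c.c3 * p ^ 2) + c.amp p + p * c.amp' p

/-- The difference quotient `(slope q - slope p) / (q - p)` of the quadratic polynomial `slope`,
as a function of `t = p + q`. -/
def slopeQuot (F : Family) (t : ℝ) : ℝ :=
  2 * F.sign * c.c2 - 2 * c.d0 + 2 * c.d1 * c.E + 3 * (F.sign * c.c3 - c.d1) * t

theorem slope_sub (F : Family) (p q : ℝ) :
    c.slope F q - c.slope F p = (q - p) * c.slopeQuot F (p + q) := by
  simp only [slope, slopeQuot, amp, amp']; ring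

theorem slope_inclined (p : ℝ) : c.slope .inclined p = c.dP p p + c.amp p := by
  simp only [slope, dP, Family.sign]; ring

theorem slope_loop (p : ℝ) : c.slope .loop p = -(c.dP p (-p) - c.amp p) := by
  simp only [slope, dP, Family.sign]; ring

theorem hasDerivAt_half_sq_add (a x : ℝ) : HasDerivAt (fun t : ℝ => (t ^ 2 + a) / 2) x x := by
  simpa using ((hasDerivAt_pow 2 x).add_const a).div_const 2

theorem hasDerivAt_half_add_sq (a x : ℝ) : HasDerivAt (fun t : ℝ => (a + t ^ 2) / 2) x x := by
  simpa using ((hasDerivAt_pow 2 x).const_add a).div_const 2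

theorem hasDerivAt_half_sub_sq (a x : ℝ) :
    HasDerivAt (fun t : ℝ => (a - t ^ 2) / 2) (-x) x := by
  simpa [neg_div] using ((hasDerivAt_pow 2 x).const_sub a).div_const 2

theorem hasDerivAt_half_sq_sub (a x : ℝ) : HasDerivAt (fun t : ℝ => (t ^ 2 - a) / 2) x x := by
  simpa using ((hasDerivAt_pow 2 x).sub_const a).div_const 2

theorem dX_ham : dX c.ham = fun z => z.1 * (c.dP ((z.1 ^ 2 + z.2 ^ 2) / 2)
    ((z.1 ^ 2 - z.2 ^ 2) / 2) + c.amp ((z.1 ^ 2 + z.2 ^ 2) / 2)) := by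
  funext ⟨x, y⟩
  have hp := hasDerivAt_half_sq_add (y ^ 2) x
  have hq := hasDerivAt_half_sq_sub (y ^ 2) x
  refine HasDerivAt.deriv ?_
  simp only [ham]
  refine HasDerivAt.congr_deriv (((((hp.const_mul c.c1).const_add c.c0).add ((hp.pow 2).const_mul c.c2)).add
    ((hp.pow 3).const_mul c.c3)).add
    (hq.mul ((hp.const_sub c.E).mul ((hp.const_mul c.d1).const_add c.d0)))) ?_
  simp only [dP, amp, amp']; push_cast; ring

theorem dY_ham : dY c.ham = fun z => z.2 * (c.dP ((z.1 ^ 2 + z.2 ^ 2) / 2)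
    ((z.1 ^ 2 - z.2 ^ 2) / 2) - c.amp ((z.1 ^ 2 + z.2 ^ 2) / 2)) := by
  funext ⟨x, y⟩
  have hp := hasDerivAt_half_add_sq (x ^ 2) y
  have hq := hasDerivAt_half_sub_sq (x ^ 2) y
  refine HasDerivAt.deriv ?_
  simp only [ham]
  refine HasDerivAt.congr_deriv (((((hp.const_mul c.c1).const_add c.c0).add ((hp.pow 2).const_mul c.c2)).add
    ((hp.pow 3).const_mul c.c3)).add
    (hq.mul ((hp.const_sub c.E).mul ((hp.const_mul c.d1).const_add c.d0)))) ?_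
  simp only [dP, amp, amp']; push_cast; ring

theorem hasDerivAt_dP {f g : ℝ → ℝ} {t f' g' : ℝ} (hf : HasDerivAt f f' t)
    (hg : HasDerivAt g g' t) :
    HasDerivAt (fun t => c.dP (f t) (g t)) (f' * c.dPP (f t) (g t) + g' * c.amp' (f t)) t := by
  simp only [dP, amp']
  refine HasDerivAt.congr_deriv ((((hf.const_mul (2 * c.c2)).const_add c.c1).add ((hf.pow 2).const_mul (3 * c.c3))).add
    (hg.mul ((hf.const_mul (2 * c.d1)).const_sub (c.d1 * c.E - c.d0)))) ?_
  simp only [dPP]; push_cast; ring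

theorem hasDerivAt_amp {f : ℝ → ℝ} {t f' : ℝ} (hf : HasDerivAt f f' t) :
    HasDerivAt (fun t => c.amp (f t)) (f' * c.amp' (f t)) t := by
  simp only [amp]
  refine HasDerivAt.congr_deriv ((hf.const_sub c.E).mul ((hf.const_mul c.d1).const_add c.d0)) ?_
  simp only [amp']; ring

theorem hessDet_ham (x y : ℝ) :
    hessDet c.ham (x, y) =
      (c.dP ((x ^ 2 + y ^ 2) / 2) ((x ^ 2 - y ^ 2) / 2) + c.amp ((x ^ 2 + y ^ 2) / 2)
        + x ^ 2 * (c.dPP ((x ^ 2 + y ^ 2) / 2) ((x ^ 2 - y ^ 2) / 2)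
          + 2 * c.amp' ((x ^ 2 + y ^ 2) / 2)))
      * (c.dP ((x ^ 2 + y ^ 2) / 2) ((x ^ 2 - y ^ 2) / 2) - c.amp ((x ^ 2 + y ^ 2) / 2)
        + y ^ 2 * (c.dPP ((x ^ 2 + y ^ 2) / 2) ((x ^ 2 - y ^ 2) / 2)
          - 2 * c.amp' ((x ^ 2 + y ^ 2) / 2)))
      - (x * y * c.dPP ((x ^ 2 + y ^ 2) / 2) ((x ^ 2 - y ^ 2) / 2)) ^ 2 := by
  have hp := hasDerivAt_half_sq_add (y ^ 2) x
  have hq := hasDerivAt_half_sq_sub (y ^ 2) x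
  have kp := hasDerivAt_half_add_sq (x ^ 2) y
  have kq := hasDerivAt_half_sub_sq (x ^ 2) y
  have hXX := ((hasDerivAt_id x).mul ((c.hasDerivAt_dP hp hq).add (c.hasDerivAt_amp hp))).deriv
  have hXY := (((c.hasDerivAt_dP hp hq).sub (c.hasDerivAt_amp hp)).const_mul y).deriv
  have hYX := (((c.hasDerivAt_dP kp kq).add (c.hasDerivAt_amp kp)).const_mul x).deriv
  have hYY := ((hasDerivAt_id y).mul ((c.hasDerivAt_dP kp kq).sub (c.hasDerivAt_amp kp))).deriv
  have e1 : dX (dX c.ham) (x, y) = _ := (congrArg (fun H => dX H (x, y)) c.dX_ham).trans hXX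
  have e2 : dX (dY c.ham) (x, y) = _ := (congrArg (fun H => dX H (x, y)) c.dY_ham).trans hXY
  have e3 : dY (dX c.ham) (x, y) = _ := (congrArg (fun H => dY H (x, y)) c.dX_ham).trans hYX
  have e4 : dY (dY c.ham) (x, y) = _ := (congrArg (fun H => dY H (x, y)) c.dY_ham).trans hYY
  rw [hessDet, e1, e2, e3, e4]
  simp only [id, Pi.add_apply, Pi.sub_apply]
  ring

/-- On the annulus, the fixed points lie on the axes of the two families. -/
theorem isFixedPoint_iff {z : ℝ × ℝ} (hz : c.amp ((z.1 ^ 2 + z.2 ^ 2) / 2) ≠ 0) :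
    IsFixedPoint c.ham z ↔
      z = (0, 0) ∨ ∃ (F : Family) (s : ℝ), s ≠ 0 ∧ z = F.point s ∧ c.slope F (s ^ 2 / 2) = 0 := by
  obtain ⟨x, y⟩ := z
  simp only [IsFixedPoint, c.dX_ham, c.dY_ham, mul_eq_zero] at hz ⊢
  constructor
  · rintro ⟨h1, h2⟩
    rcases eq_or_ne x 0 with rfl | hx
    · rcases eq_or_ne y 0 with rfl | hy
      · exact Or.inl rfl
      · refine Or.inr ⟨.loop, y, hy, rfl, ?_⟩
        have := h2.resolve_left hy
        rw [slope_loop, neg_eq_zero]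
        convert this using 3 <;> ring
    · have h1' := h1.resolve_left hx
      rcases h2 with rfl | h2
      · refine Or.inr ⟨.inclined, x, hx, rfl, ?_⟩
        rw [slope_inclined]
        convert h1' using 3 <;> ring
      · exact absurd (by linarith) hz
  · rintro (h | ⟨F, s, -, h, hs⟩)
    · cases h; simp
    · cases F <;> cases h
      · refine ⟨Or.inr ?_, Or.inl rfl⟩
        rw [slope_inclined] at hs
        refine Eq.trans ?_ hs; ring_nf
      · refine ⟨Or.inl rfl, Or.inr ?_⟩
        rw [slope_loop, neg_eq_zero] at hs
        refine Eq.trans ?_ hs; ring_nf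

theorem isFixedPoint_zero : IsFixedPoint c.ham (0, 0) := by
  simp [IsFixedPoint, c.dX_ham, c.dY_ham]

theorem hessDet_zero :
    hessDet c.ham (0, 0) = -(c.slope .inclined 0 * c.slope .loop 0) := by
  rw [hessDet_ham]; simp only [slope, dP, Family.sign]; ring_nf

theorem hessDet_point (F : Family) {s : ℝ} (hs : c.slope F (s ^ 2 / 2) = 0) :
    hessDet c.ham (F.point s)
      = -2 * c.amp (s ^ 2 / 2) * s ^ 2 * c.slopeQuot F (s ^ 2) := by
  cases F <;> simp only [Family.point, hessDet_ham]
  · rw [slope_inclined] at hs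
    have h : c.dP (s ^ 2 / 2) (s ^ 2 / 2) = -c.amp (s ^ 2 / 2) := by linarith
    simp only [ne_eq, OfNat.ofNat_ne_zero, not_false_eq_true, zero_pow, add_zero, sub_zero, h]
    simp only [slopeQuot, Family.sign, dPP, amp']; ring
  · rw [slope_loop] at hs
    have h : c.dP (s ^ 2 / 2) (-(s ^ 2 / 2)) = c.amp (s ^ 2 / 2) := by linarith
    simp only [ne_eq, OfNat.ofNat_ne_zero, not_false_eq_true, zero_pow, zero_add, zero_sub,
      neg_div, h]
    simp only [slopeQuot, Family.sign, dPP, amp']; ring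

/-- The regime of small energy and detuning: the `q`-dependence does not degenerate, and both
`slope`s decrease at a rate of at least `m`. -/
structure Tame (m : ℝ) : Prop where
  m_pos : 0 < m
  E_pos : 0 < c.E
  amp_ge : ∀ p, 0 ≤ p → p ≤ c.E → m ≤ c.d0 + c.d1 * p
  quot_le : ∀ F t, 0 ≤ t → t ≤ 2 * c.E → c.slopeQuot F t ≤ -m

variable {c} {m : ℝ}

namespace Tame

variable (hc : c.Tame m)
include hc

theorem amp_pos {p : ℝ} (h0 : 0 ≤ p) (h1 : p < c.E) : 0 < c.amp p :=
  mul_pos (by linarith) (hc.m_pos.trans_le (hc.amp_ge p h0 h1.le))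

theorem slope_le (F : Family) {p q : ℝ} (hp : 0 ≤ p) (hpq : p ≤ q) (hq : q ≤ c.E) :
    c.slope F q ≤ c.slope F p - m * (q - p) := by
  have := c.slope_sub F p q
  nlinarith [hc.quot_le F (p + q) (by linarith) (by linarith)]

theorem slope_injOn (F : Family) {p q : ℝ} (hp : 0 ≤ p) (hp' : p ≤ c.E) (hq : 0 ≤ q)
    (hq' : q ≤ c.E) (h : c.slope F p = c.slope F q) : p = q := by
  have := hc.m_pos
  rcases le_total p q with hpq | hpq
  · nlinarith [hc.slope_le F hp hpq hq']
  · nlinarith [hc.slope_le F hq hpq hp']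

end Tame

end Chart

end

noncomputable section

/-! ### The charts of the normal form -/

/-- The opposite normal mode. -/
def Mode.other : Mode → Mode
  | .one => .two
  | .two => .one

/-- The data of the normal form in the chart centred at a normal mode. -/
def chart (v : Coeffs) (δ E : ℝ) : Mode → Chart
  | .one =>
    { c0 := E + 3 / 2 * v.v04 * E ^ 2 + 1 / 4 * (10 * v.v06 - 17 * v.v04 ^ 2) * E ^ 3
      c1 := δ - 3 * v.v04 * E + v.v22 * E * (1 - δ)
        - 3 / 4 * (10 * v.v06 - 17 * v.v04 ^ 2) * E ^ 2
        + 1 / 4 * (6 * v.v24 - 9 / 4 * v.v22 ^ 2 - 12 * v.v22 * v.v04) * E ^ 2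
      c2 := 3 / 2 * v.v40 + 3 / 2 * v.v04 - 3 * v.v40 * δ - v.v22 * (1 - δ)
        + 3 / 4 * (10 * v.v06 - 17 * v.v04 ^ 2) * E
        + 1 / 4 * (6 * v.v42 - 9 / 4 * v.v22 ^ 2 - 12 * v.v22 * v.v40) * E
        - 1 / 2 * (6 * v.v24 - 9 / 4 * v.v22 ^ 2 - 12 * v.v22 * v.v04) * E
      c3 := 1 / 4 * (10 * v.v60 - 17 * v.v40 ^ 2) - 1 / 4 * (10 * v.v06 - 17 * v.v04 ^ 2)
        - 1 / 4 * (6 * v.v42 - 9 / 4 * v.v22 ^ 2 - 12 * v.v22 * v.v40)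
        + 1 / 4 * (6 * v.v24 - 9 / 4 * v.v22 ^ 2 - 12 * v.v22 * v.v04)
      d0 := v.v22 * (1 - δ) / 2 + 1 / 4 * (4 * v.v24 - 2 * v.v22 ^ 2 - 5 * v.v22 * v.v04) * E
      d1 := 1 / 4 * (4 * v.v42 - 2 * v.v22 ^ 2 - 5 * v.v22 * v.v40)
        - 1 / 4 * (4 * v.v24 - 2 * v.v22 ^ 2 - 5 * v.v22 * v.v04)
      E := E }
  | .two =>
    { c0 := E + δ * E + 3 / 2 * v.v40 * E ^ 2 - 3 * v.v40 * δ * E ^ 2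
        + 1 / 4 * (10 * v.v60 - 17 * v.v40 ^ 2) * E ^ 3
      c1 := -δ - 3 * v.v40 * E + 6 * v.v40 * δ * E + v.v22 * E * (1 - δ)
        - 3 / 4 * (10 * v.v60 - 17 * v.v40 ^ 2) * E ^ 2
        + 1 / 4 * (6 * v.v42 - 9 / 4 * v.v22 ^ 2 - 12 * v.v22 * v.v40) * E ^ 2
      c2 := 3 / 2 * v.v40 + 3 / 2 * v.v04 - 3 * v.v40 * δ - v.v22 * (1 - δ)
        + 3 / 4 * (10 * v.v60 - 17 * v.v40 ^ 2) * E
        + 1 / 4 * (6 * v.v24 - 9 / 4 * v.v22 ^ 2 - 12 * v.v22 * v.v04) * E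
        - 1 / 2 * (6 * v.v42 - 9 / 4 * v.v22 ^ 2 - 12 * v.v22 * v.v40) * E
      c3 := 1 / 4 * (10 * v.v06 - 17 * v.v04 ^ 2) - 1 / 4 * (10 * v.v60 - 17 * v.v40 ^ 2)
        - 1 / 4 * (6 * v.v24 - 9 / 4 * v.v22 ^ 2 - 12 * v.v22 * v.v04)
        + 1 / 4 * (6 * v.v42 - 9 / 4 * v.v22 ^ 2 - 12 * v.v22 * v.v40)
      d0 := v.v22 * (1 - δ) / 2 + 1 / 4 * (4 * v.v42 - 2 * v.v22 ^ 2 - 5 * v.v22 * v.v40) * E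
      d1 := 1 / 4 * (4 * v.v24 - 2 * v.v22 ^ 2 - 5 * v.v22 * v.v04)
        - 1 / 4 * (4 * v.v42 - 2 * v.v22 ^ 2 - 5 * v.v22 * v.v40)
      E := E }

variable (v : Coeffs) (δ E : ℝ) (k : Mode) (F : Family)

@[simp] theorem chart_E : (chart v δ E k).E = E := by cases k <;> rfl

theorem planarHam_eq : planarHam v δ E k = (chart v δ E k).ham := by
  funext z
  cases k <;> simp only [planarHam, normalForm, Chart.ham, chart] <;> ring

/-- The slope at the mode `k`, in its own chart, of the Hamiltonian along the axis of `F`. -/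
def modeSlope : ℝ := (chart v δ E k).slope F 0

theorem modeSlope_eq :
    modeSlope v δ E k F = F.sign * (chart v δ E k).c1 + E * (chart v δ E k).d0 := by
  simp only [modeSlope, Chart.slope, Chart.amp, chart_E]; ring

/-- The two charts are related by `p ↦ E - p`. -/
theorem slope_action : (chart v δ E k).slope F E = -modeSlope v δ E k.other F := by
  cases k <;> cases F <;>
    simp only [modeSlope, Chart.slope, Chart.amp, Chart.amp', chart, Mode.other, Family.sign] <;>
    ring

theorem continuous_modeSlope : Continuous fun E => modeSlope v δ E k F := by
  cases k <;> cases F <;> simp only [modeSlope_eq, chart, Family.sign] <;> fun_prop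

theorem modeStable_iff :
    ModeStable v δ E k ↔ modeSlope v δ E k .inclined * modeSlope v δ E k .loop < 0 := by
  simp [ModeStable, IsStable, planarHam_eq, Chart.isFixedPoint_zero, Chart.hessDet_zero,
    modeSlope]

theorem modeSaddle_iff :
    ModeSaddle v δ E k ↔ 0 < modeSlope v δ E k .inclined * modeSlope v δ E k .loop := by
  simp [ModeSaddle, IsSaddle, planarHam_eq, Chart.isFixedPoint_zero, Chart.hessDet_zero,
    modeSlope]

/-! ### Fixed points in general position -/

variable {v δ E k F} {m : ℝ}

theorem norm_sq_point (F : Family) (s : ℝ) : (F.point s).1 ^ 2 + (F.point s).2 ^ 2 = s ^ 2 := by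
  cases F <;> simp [Family.point]

theorem point_injective (F : Family) : Function.Injective F.point := by
  intro s t h; cases F <;> simpa [Family.point] using h

theorem mem_fixedPoints_iff (hc : (chart v δ E k).Tame m) {z : ℝ × ℝ} :
    z ∈ fixedPoints v δ E k ↔ ∃ (F : Family) (s : ℝ), z = F.point s ∧ s ≠ 0 ∧ s ^ 2 < 2 * E ∧
      (chart v δ E k).slope F (s ^ 2 / 2) = 0 := by
  simp only [fixedPoints, mem_ofPred_eq, planarHam_eq]
  constructor
  · rintro ⟨h0, h1, h⟩
    have := hc.amp_pos (p := (z.1 ^ 2 + z.2 ^ 2) / 2) (by linarith)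
      (by rw [chart_E]; linarith)
    rcases (Chart.isFixedPoint_iff _ this.ne').1 h with rfl | ⟨F, s, hs, rfl, h'⟩
    · simp at h0
    · exact ⟨F, s, rfl, hs, by rwa [norm_sq_point] at h1, h'⟩
  · rintro ⟨F, s, rfl, hs, h1, h⟩
    rw [norm_sq_point]
    refine ⟨by positivity, h1, ?_⟩
    refine (Chart.isFixedPoint_iff _ ?_).2 (Or.inr ⟨F, s, hs, rfl, h⟩)
    rw [norm_sq_point]
    exact (hc.amp_pos (by positivity) (by rw [chart_E]; linarith)).ne'

theorem mem_familyPoints_iff (hc : (chart v δ E k).Tame m) {z : ℝ × ℝ} :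
    z ∈ familyPoints v δ E k F ↔ ∃ s : ℝ, z = F.point s ∧ s ≠ 0 ∧ s ^ 2 < 2 * E ∧
      (chart v δ E k).slope F (s ^ 2 / 2) = 0 := by
  rw [familyPoints, mem_inter_iff, mem_fixedPoints_iff hc]
  constructor
  · rintro ⟨⟨G, s, rfl, hs, h1, h⟩, t, ht⟩
    -- the two axes meet only at the origin
    have hFG : F = G := by
      cases F <;> cases G <;> simp [Family.point] at ht ⊢ <;>
        first | exact hs ht.1.symm | exact hs ht.2.symm
    subst hFG
    exact ⟨s, rfl, hs, h1, h⟩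
  · rintro ⟨s, rfl, h⟩
    exact ⟨⟨F, s, rfl, h⟩, s, rfl⟩

theorem isStable_of_mem_familyPoints (hc : (chart v δ E k).Tame m) {z : ℝ × ℝ}
    (hz : z ∈ familyPoints v δ E k F) : IsStable (planarHam v δ E k) z := by
  refine ⟨hz.1.2.2, ?_⟩
  obtain ⟨s, rfl, hs, h1, h⟩ := (mem_familyPoints_iff hc).1 hz
  rw [planarHam_eq, Chart.hessDet_point _ _ h]
  have ha := hc.amp_pos (p := s ^ 2 / 2) (by positivity) (by rw [chart_E]; linarith)
  have hq := hc.quot_le F (s ^ 2) (by positivity) (by rw [chart_E]; linarith)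
  have := hc.m_pos
  have hs2 : 0 < s ^ 2 := by positivity
  nlinarith [mul_pos (mul_pos ha hs2) (show 0 < -(chart v δ E k).slopeQuot F (s ^ 2) by linarith)]

/-- A family with positive slope at both modes consists of one symmetric pair. -/
theorem exists_pair (hc : (chart v δ E k).Tame m) (h0 : 0 < modeSlope v δ E k F)
    (h1 : 0 < modeSlope v δ E k.other F) :
    ∃ s, 0 < s ∧ s ^ 2 / 2 ≤ modeSlope v δ E k F / m ∧
      familyPoints v δ E k F = {F.point s, F.point (-s)} := by
  have hE : 0 < E := by simpa using hc.E_pos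
  have hcont : Continuous ((chart v δ E k).slope F) := by
    unfold Chart.slope Chart.amp Chart.amp'; fun_prop
  obtain ⟨p, ⟨hp0, hpE⟩, hp⟩ : ∃ p ∈ Ioo 0 E, (chart v δ E k).slope F p = 0 := by
    refine intermediate_value_Ioo' hE.le hcont.continuousOn ⟨?_, h0⟩
    rw [slope_action]; linarith
  have hs : √(2 * p) ^ 2 = 2 * p := Real.sq_sqrt (by linarith)
  have hs2 : √(2 * p) ^ 2 / 2 = p := by linarith
  refine ⟨√(2 * p), Real.sqrt_pos.2 (by linarith), ?_, ?_⟩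
  · rw [hs2, le_div_iff₀ hc.m_pos]
    have := hc.slope_le F le_rfl hp0.le (by simpa using hpE.le)
    rw [hp] at this
    rw [modeSlope]; linarith
  · ext z
    rw [mem_familyPoints_iff hc]
    constructor
    · rintro ⟨t, rfl, ht, ht2, h⟩
      have : t ^ 2 / 2 = p := hc.slope_injOn F (by positivity) (by rw [chart_E]; linarith)
        hp0.le (by simpa using hpE.le) (h.trans hp.symm)
      have : t ^ 2 = √(2 * p) ^ 2 := by linarith
      rcases sq_eq_sq_iff_eq_or_eq_neg.1 this with rfl | rfl <;> simp
    · have hne : √(2 * p) ≠ 0 := (Real.sqrt_pos.2 (by linarith)).ne'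
      rintro (rfl | rfl)
      · exact ⟨_, rfl, hne, by linarith, by rw [hs2, hp]⟩
      · exact ⟨_, rfl, neg_ne_zero.2 hne, by rw [neg_sq]; linarith, by rw [neg_sq, hs2, hp]⟩

theorem familyPoints_eq_empty (hc : (chart v δ E k).Tame m)
    (h : modeSlope v δ E k F ≤ 0 ∨ modeSlope v δ E k.other F ≤ 0) :
    familyPoints v δ E k F = ∅ := by
  have hE : 0 < E := by simpa using hc.E_pos
  refine eq_empty_of_forall_notMem fun z hz => ?_
  obtain ⟨s, rfl, hs, h1, hs'⟩ := (mem_familyPoints_iff hc).1 hz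
  have hs2 : 0 < s ^ 2 := by positivity
  have hm := hc.m_pos
  rcases h with h | h
  · have := hc.slope_le F le_rfl (q := s ^ 2 / 2) (by linarith) (by rw [chart_E]; linarith)
    rw [modeSlope] at h
    nlinarith
  · have := hc.slope_le F (p := s ^ 2 / 2) (q := E) (by linarith) (by linarith) (by simp)
    rw [slope_action] at this
    nlinarith

theorem encard_familyPoints (hc : (chart v δ E k).Tame m) :
    (familyPoints v δ E k F).encard =
      if 0 < modeSlope v δ E k F ∧ 0 < modeSlope v δ E k.other F then 2 else 0 := by
  split_ifs with h
  · obtain ⟨s, hs, -, h⟩ := exists_pair hc h.1 h.2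
    rw [h, encard_pair]
    exact fun h => by linarith [point_injective F h]
  · rw [familyPoints_eq_empty hc, encard_empty]
    by_contra! h'
    exact h h'

theorem encard_fixedPoints (hc : (chart v δ E k).Tame m) :
    (fixedPoints v δ E k).encard = (familyPoints v δ E k .inclined).encard
      + (familyPoints v δ E k .loop).encard := by
  rw [← encard_union_eq]
  · congr 1
    ext z
    simp only [mem_union, mem_familyPoints_iff hc, mem_fixedPoints_iff hc]
    constructor
    · rintro ⟨F, h⟩
      cases F
      exacts [Or.inl h, Or.inr h]
    · rintro (h | h)
      exacts [⟨_, h⟩, ⟨_, h⟩]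
  · rw [Set.disjoint_left]
    intro z hz hz'
    obtain ⟨s, rfl, hs, -⟩ := (mem_familyPoints_iff hc).1 hz
    obtain ⟨t, ht, -⟩ := (mem_familyPoints_iff hc).1 hz'
    simp [Family.point, hs] at ht

theorem familyPoints_inter_stable (hc : (chart v δ E k).Tame m) :
    familyPoints v δ E k F ∩ {z | IsStable (planarHam v δ E k) z} = familyPoints v δ E k F :=
  inter_eq_left.2 fun _ hz => isStable_of_mem_familyPoints hc hz

theorem familyPoints_inter_saddle (hc : (chart v δ E k).Tame m) :
    familyPoints v δ E k F ∩ {z | IsSaddle (planarHam v δ E k) z} = ∅ :=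
  eq_empty_of_forall_notMem fun _ hz =>
    lt_asymm hz.2.2 (isStable_of_mem_familyPoints hc hz.1).2

/-- The signs of the four slopes at the modes determine the phase portrait. -/
theorem sameNature_of_sign {E' : ℝ} (hc : (chart v δ E .one).Tame m)
    (hc' : (chart v δ E' .one).Tame m)
    (h : ∀ k F, SignType.sign (modeSlope v δ E' k F) = SignType.sign (modeSlope v δ E k F)) :
    SameNature v δ E E' := by
  have hpos : ∀ k F, (0 < modeSlope v δ E' k F ↔ 0 < modeSlope v δ E k F) := fun k F => by
    rw [← sign_eq_one_iff, h, sign_eq_one_iff]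
  have hfam : ∀ F, (familyPoints v δ E .one F).encard = (familyPoints v δ E' .one F).encard := by
    intro F
    simp only [encard_familyPoints hc, encard_familyPoints hc', hpos]
  have hsign : ∀ k, SignType.sign (modeSlope v δ E' k .inclined * modeSlope v δ E' k .loop)
      = SignType.sign (modeSlope v δ E k .inclined * modeSlope v δ E k .loop) := fun k => by
    rw [sign_mul, sign_mul, h, h]
  refine ⟨?_, fun F => ⟨hfam F, ?_, ?_⟩, fun k => ⟨?_, ?_⟩⟩
  · rw [encard_fixedPoints hc, encard_fixedPoints hc', hfam, hfam]
  · rw [familyPoints_inter_stable hc, familyPoints_inter_stable hc', hfam]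
  · rw [familyPoints_inter_saddle hc, familyPoints_inter_saddle hc']
  · rw [modeStable_iff, modeStable_iff, ← sign_eq_neg_one_iff, ← sign_eq_neg_one_iff, hsign]
  · rw [modeSaddle_iff, modeSaddle_iff, ← sign_eq_one_iff, ← sign_eq_one_iff, hsign]

theorem eventually_sameNature (hc : ∀ᶠ E' in 𝓝 E, (chart v δ E' .one).Tame m)
    (h : ∀ k F, modeSlope v δ E k F ≠ 0) : ∀ᶠ E' in 𝓝 E, SameNature v δ E E' := by
  have hs : ∀ k F, ∀ᶠ E' in 𝓝 E,
      SignType.sign (modeSlope v δ E' k F) = SignType.sign (modeSlope v δ E k F) := by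
    intro k F
    have hcont := (continuous_modeSlope v δ k F).continuousAt (x := E)
    rcases (h k F).lt_or_gt with h | h
    · filter_upwards [hcont.eventually_lt_const h] with E' hE'
      rw [sign_neg hE', sign_neg h]
    · filter_upwards [hcont.eventually_const_lt h] with E' hE'
      rw [sign_pos hE', sign_pos h]
  filter_upwards [hc, hs .one .inclined, hs .one .loop, hs .two .inclined, hs .two .loop]
    with E' hE' h1 h2 h3 h4
  refine sameNature_of_sign hc.self_of_nhds hE' fun k F => ?_
  cases k <;> cases F <;> assumption

theorem modeSlope_add_pos (hc : (chart v δ E k).Tame m) :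
    0 < modeSlope v δ E k F + modeSlope v δ E k F.other := by
  have hE : 0 < E := by simpa using hc.E_pos
  have := hc.amp_ge 0 le_rfl hc.E_pos.le
  have hd : 0 < E * (chart v δ E k).d0 := mul_pos hE (by linarith [hc.m_pos])
  cases F <;> simp only [modeSlope_eq, Family.other, Family.sign] <;> linarith

theorem modeSlope_other_add_pos (hc : (chart v δ E k).Tame m) :
    0 < modeSlope v δ E k F + modeSlope v δ E k.other F := by
  have hE : 0 < E := by simpa using hc.E_pos
  have := hc.slope_le F le_rfl hE.le (by simp)
  rw [slope_action] at this
  have hm := mul_pos hc.m_pos hE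
  simp only [modeSlope] at *
  linarith

theorem modeSlope_mul (k : Mode) (F : Family) :
    modeSlope v δ E k .inclined * modeSlope v δ E k .loop
      = modeSlope v δ E k F * modeSlope v δ E k F.other := by
  cases F
  · rfl
  · exact mul_comm _ _

/-- The local bifurcation at a mode: when its slope along the axis of `F` passes through zero
towards positive values, a stable pair branches off, because the slope along the other axis and
the slope at the other mode are positive at that moment. -/
theorem stablePairBranches_of_modeSlope {e : ℝ} {without present : Filter ℝ}
    (hw : without ≤ 𝓝 e) (hp : present ≤ 𝓝 e) (hc : ∀ᶠ E in 𝓝 e, (chart v δ E k).Tame m)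
    (h0 : modeSlope v δ e k F = 0) (hneg : ∀ᶠ E in without, modeSlope v δ E k F < 0)
    (hpos : ∀ᶠ E in present, 0 < modeSlope v δ E k F) :
    StablePairBranches v δ k F without present := by
  have hm := hc.self_of_nhds.m_pos
  have ho : ∀ᶠ E in 𝓝 e, 0 < modeSlope v δ E k F.other := by
    have := modeSlope_add_pos (F := F) hc.self_of_nhds
    rw [h0, zero_add] at this
    exact (continuous_modeSlope v δ k F.other).continuousAt.eventually_const_lt this
  have ho' : ∀ᶠ E in 𝓝 e, 0 < modeSlope v δ E k.other F := by
    have := modeSlope_other_add_pos (F := F) hc.self_of_nhds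
    rw [h0, zero_add] at this
    exact (continuous_modeSlope v δ k.other F).continuousAt.eventually_const_lt this
  refine ⟨?_, ?_⟩
  · filter_upwards [hneg, hw hc, hw ho] with E h1 h2 h3
    refine ⟨familyPoints_eq_empty h2 (Or.inl h1.le), ?_⟩
    rw [modeStable_iff, modeSlope_mul k F]
    exact mul_neg_of_neg_of_pos h1 h3
  · have hex : ∀ E, ∃ s, (chart v δ E k).Tame m → 0 < modeSlope v δ E k F →
        0 < modeSlope v δ E k.other F → 0 < s ∧ s ^ 2 / 2 ≤ modeSlope v δ E k F / m ∧
          familyPoints v δ E k F = {F.point s, F.point (-s)} := by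
      intro E
      by_cases h : (chart v δ E k).Tame m ∧ 0 < modeSlope v δ E k F ∧
        0 < modeSlope v δ E k.other F
      · obtain ⟨s, hs⟩ := exists_pair h.1 h.2.1 h.2.2
        exact ⟨s, fun _ _ _ => hs⟩
      · exact ⟨0, fun h1 h2 h3 => (h ⟨h1, h2, h3⟩).elim⟩
    choose s hs using hex
    have hs' : ∀ᶠ E in present, 0 < s E ∧ s E ^ 2 / 2 ≤ modeSlope v δ E k F / m ∧
        familyPoints v δ E k F = {F.point (s E), F.point (-s E)} := by
      filter_upwards [hp hc, hpos, hp ho'] with E h1 h2 h3 using hs E h1 h2 h3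
    refine ⟨s, ?_, ?_⟩
    · have hlim : Tendsto (fun E => √(2 * (modeSlope v δ E k F / m))) present (𝓝 0) := by
        have : Continuous fun E => √(2 * (modeSlope v δ E k F / m)) :=
          (((continuous_modeSlope v δ k F).div_const m).const_mul 2).sqrt
        simpa [h0] using (this.tendsto e).mono_left hp
      refine squeeze_zero' (hs'.mono fun E h => h.1.le) (hs'.mono fun E h => ?_) hlim
      exact Real.le_sqrt_of_sq_le (by linarith [h.2.1])
    · filter_upwards [hs', hp hc, hpos, hp ho] with E h1 h2 h3 h4
      refine ⟨h1.1, h1.2.2, ?_, ?_, ?_⟩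
      · exact isStable_of_mem_familyPoints (F := F) h2 (by rw [h1.2.2]; simp)
      · exact isStable_of_mem_familyPoints (F := F) h2 (by rw [h1.2.2]; simp)
      · rw [modeSaddle_iff, modeSlope_mul k F]
        exact mul_pos h3 h4

end

noncomputable section

/-! ### Heteroclinic connections -/

namespace Chart

variable (c : Chart)

/-- The part of the Hamiltonian that does not depend on `ψ`. -/
def radial (J : ℝ) : ℝ := c.c0 + c.c1 * J + c.c2 * J ^ 2 + c.c3 * J ^ 3

/-- The difference quotient of `radial` between the two modes. -/
def gap : ℝ := c.c1 + c.c2 * c.E + c.c3 * c.E ^ 2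

/-- The Hamiltonian in the action-angle variables `J = p` and `ψ`. -/
def polar (J ψ : ℝ) : ℝ := c.radial J + J * c.amp J * Real.cos (2 * ψ)

/-- The partial derivative of `polar` in `J`. -/
def polarJ (J ψ : ℝ) : ℝ :=
  c.c1 + 2 * c.c2 * J + 3 * c.c3 * J ^ 2 + (c.amp J + J * c.amp' J) * Real.cos (2 * ψ)

/-- The partial derivative of `polar` in `ψ`. -/
def polarψ (J ψ : ℝ) : ℝ := -2 * (J * c.amp J) * Real.sin (2 * ψ)

theorem radial_sub : c.radial c.E - c.radial 0 = c.E * c.gap := by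
  simp only [radial, gap]; ring

theorem hasDerivAt_polar {J ψ : ℝ → ℝ} {J' ψ' t : ℝ} (hJ : HasDerivAt J J' t)
    (hψ : HasDerivAt ψ ψ' t) :
    HasDerivAt (fun t => c.polar (J t) (ψ t))
      (c.polarJ (J t) (ψ t) * J' + c.polarψ (J t) (ψ t) * ψ') t := by
  simp only [polar, radial]
  refine HasDerivAt.congr_deriv (((((hJ.const_mul c.c1).const_add c.c0).add
    ((hJ.pow 2).const_mul c.c2)).add ((hJ.pow 3).const_mul c.c3)).add
    ((hJ.mul (c.hasDerivAt_amp hJ)).mul (hψ.const_mul 2).cos)) ?_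
  simp only [polarJ, polarψ, Pi.mul_apply]; push_cast; ring

theorem deriv_polar_left (J ψ : ℝ) : deriv (fun I => c.polar I ψ) J = c.polarJ J ψ := by
  simpa using (c.hasDerivAt_polar (hasDerivAt_id J) (hasDerivAt_const J ψ)).deriv

theorem deriv_polar_right (J ψ : ℝ) : deriv (fun θ => c.polar J θ) ψ = c.polarψ J ψ := by
  simpa using (c.hasDerivAt_polar (hasDerivAt_const ψ J) (hasDerivAt_id ψ)).deriv

end Chart

variable {v : Coeffs} {δ E : ℝ}

theorem effHam_eq (J ψ : ℝ) : effHam v δ E J ψ = (chart v δ E .one).polar J ψ := by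
  simp only [effHam, normalForm, Chart.polar, Chart.radial, Chart.amp, chart]; ring

theorem hasConnection_iff {k l : Mode} :
    HasConnection v δ E k l ↔ ∃ J ψ : ℝ → ℝ, (∀ t, 0 < J t ∧ J t < E) ∧
      (∀ t, HasDerivAt J ((chart v δ E .one).polarψ (J t) (ψ t)) t) ∧
      (∀ t, HasDerivAt ψ (-(chart v δ E .one).polarJ (J t) (ψ t)) t) ∧
      Tendsto J atBot (𝓝 (k.action E)) ∧ Tendsto J atTop (𝓝 (l.action E)) := by
  simp only [HasConnection, effHam_eq, Chart.deriv_polar_left, Chart.deriv_polar_right]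

/-- Time reversal, together with the reflection `ψ ↦ -ψ`. -/
theorem HasConnection.symm {k l : Mode} (h : HasConnection v δ E k l) :
    HasConnection v δ E l k := by
  rw [hasConnection_iff] at h ⊢
  obtain ⟨J, ψ, h0, hJ, hψ, hk, hl⟩ := h
  refine ⟨fun t => J (-t), fun t => -ψ (-t), fun t => h0 _, fun t => ?_, fun t => ?_,
    hl.comp tendsto_neg_atBot_atTop, hk.comp tendsto_neg_atTop_atBot⟩
  · refine ((hJ (-t)).comp t (hasDerivAt_neg t)).congr_deriv ?_
    simp [Chart.polarψ]
  · refine (((hψ (-t)).comp t (hasDerivAt_neg t)).neg).congr_deriv ?_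
    simp [Chart.polarJ]

/-- A connection forces the two modes to lie on the same level of the Hamiltonian. -/
theorem HasConnection.gap_eq_zero (hE : 0 < E) (h : HasConnection v δ E .one .two) :
    (chart v δ E .one).gap = 0 := by
  obtain ⟨J, ψ, -, hJ, hψ, hk, hl⟩ := hasConnection_iff.1 h
  set c := chart v δ E .one with hc
  have hcE : c.E = E := by simp [hc]
  have hd : ∀ t, HasDerivAt (fun t => c.polar (J t) (ψ t)) 0 t := fun t =>
    (c.hasDerivAt_polar (hJ t) (hψ t)).congr_deriv (by ring)
  have hconst : ∀ t, c.polar (J t) (ψ t) = c.polar (J 0) (ψ 0) := fun t =>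
    is_const_of_deriv_eq_zero (fun t => (hd t).differentiableAt) (fun t => (hd t).deriv) t 0
  have hlim : ∀ {f : Filter ℝ} [f.NeBot] {a : ℝ}, a * c.amp a = 0 → Tendsto J f (𝓝 a) →
      c.radial a = c.polar (J 0) (ψ 0) := by
    intro f _ a ha hf
    have h1 : Continuous fun x => x * c.amp x := by unfold Chart.amp; fun_prop
    have h2 : Continuous c.radial := by unfold Chart.radial; fun_prop
    have h3 : Tendsto (fun t => J t * c.amp (J t) * Real.cos (2 * ψ t)) f (𝓝 0) := by
      refine squeeze_zero_norm' (a := fun t => ‖J t * c.amp (J t)‖)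
        (Eventually.of_forall fun t => ?_) ?_
      · rw [norm_mul]
        exact mul_le_of_le_one_right (norm_nonneg _) (Real.abs_cos_le_one _)
      · have := ((h1.tendsto a).comp hf).norm
        rw [ha, norm_zero] at this
        exact this
    have h4 := ((h2.tendsto a).comp hf).add h3
    rw [add_zero] at h4
    refine tendsto_nhds_unique h4 (Tendsto.congr (fun t => ?_) tendsto_const_nhds)
    rw [← hconst t]; rfl
  have e0 := hlim (by simp [Mode.action]) hk
  have e1 := hlim (by simp [Mode.action, Chart.amp, hcE]) hl
  have := c.radial_sub
  simp only [Mode.action] at e0 e1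
  rw [hcE, e0, e1, sub_self] at this
  exact (mul_eq_zero.1 this.symm).resolve_left hE.ne'

/-- An autonomous scalar equation with bounded positive right-hand side has a solution that runs
through the whole line: invert the time function `y ↦ ∫₀ʸ 1 / f`. -/
theorem exists_solution_of_pos {f : ℝ → ℝ} {M : ℝ} (hf : Continuous f) (h0 : ∀ y, 0 < f y)
    (hM : ∀ y, f y ≤ M) : ∃ y : ℝ → ℝ, (∀ t, HasDerivAt y (f (y t)) t) ∧
      Tendsto y atBot atBot ∧ Tendsto y atTop atTop := by
  have hM0 : 0 < M := (h0 0).trans_le (hM 0)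
  have hfi : Continuous fun y => (f y)⁻¹ := hf.inv₀ fun y => (h0 y).ne'
  set τ : ℝ → ℝ := fun y => ∫ x in (0 : ℝ)..y, (f x)⁻¹ with hτ
  have hd : ∀ y, HasDerivAt τ (f y)⁻¹ y := fun y =>
    intervalIntegral.integral_hasDerivAt_right (hfi.intervalIntegrable _ _)
      (hfi.stronglyMeasurableAtFilter _ _) hfi.continuousAt
  have hmono : StrictMono τ := strictMono_of_deriv_pos fun y => by
    rw [(hd y).deriv]; exact inv_pos.2 (h0 y)
  have hcmp : Monotone fun y => τ y - M⁻¹ * y := by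
    have hd' : ∀ y, HasDerivAt (fun y => τ y - M⁻¹ * y) ((f y)⁻¹ - M⁻¹) y := fun y => by
      exact ((hd y).sub ((hasDerivAt_id y).const_mul M⁻¹)).congr_deriv (by simp)
    refine monotone_of_deriv_nonneg (fun y => (hd' y).differentiableAt) fun y => ?_
    rw [(hd' y).deriv, sub_nonneg]
    exact inv_anti₀ (h0 y) (hM y)
  have hτ0 : τ 0 = 0 := by simp [hτ]
  have htop : Tendsto τ atTop atTop := by
    refine tendsto_atTop_mono' atTop ?_ (tendsto_id.const_mul_atTop (inv_pos.2 hM0))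
    filter_upwards [eventually_ge_atTop 0] with y hy
    simpa [hτ0] using hcmp hy
  have hbot : Tendsto τ atBot atBot := by
    refine tendsto_atBot_mono' atBot ?_ (tendsto_id.const_mul_atBot (inv_pos.2 hM0))
    filter_upwards [eventually_le_atBot 0] with y hy
    simpa [hτ0] using hcmp hy
  have hcont : Continuous τ := continuous_iff_continuousAt.2 fun y => (hd y).continuousAt
  let e := hmono.orderIsoOfSurjective τ (hcont.surjective htop hbot)
  have he : ∀ t, τ (e.symm t) = t := fun t => e.apply_symm_apply t
  refine ⟨e.symm, fun t => ?_, e.symm.tendsto_atBot, e.symm.tendsto_atTop⟩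
  have := HasDerivAt.of_local_left_inverse e.symm.continuous.continuousAt (hd (e.symm t))
    (inv_pos.2 (h0 _)).ne' (Eventually.of_forall he)
  rwa [inv_inv] at this

/-- If both modes are saddles on the same level, this level contains a connecting curve
`cos 2ψ = R / Q` with `R` and `Q` affine in `J`. The equation on it is solved in the variable `y`
with `J = E / (1 + exp (-y))`. -/
theorem hasConnection_of_gap_eq_zero {m : ℝ} (hT : (chart v δ E .one).Tame m)
    (hgap : (chart v δ E .one).gap = 0) (hpos : ∀ k F, 0 < modeSlope v δ E k F) :
    HasConnection v δ E .one .two := by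
  have hE : 0 < E := by simpa using hT.E_pos
  rw [hasConnection_iff]
  have h2 : ∀ F, 0 < -(chart v δ E .one).slope F E := fun F => by
    rw [slope_action, neg_neg]; exact hpos .two F
  have h1 : ∀ F, 0 < (chart v δ E .one).slope F 0 := hpos .one
  have hcE : (chart v δ E .one).E = E := by simp
  generalize chart v δ E .one = c at *
  set Q : ℝ → ℝ := fun J => c.d0 + c.d1 * J with hQ
  set R : ℝ → ℝ := fun J => c.c2 + c.c3 * (J + E) with hR
  have hc1 : c.c1 = -E * (c.c2 + c.c3 * E) := by
    simp only [Chart.gap, hcE] at hgap; linarith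
  have hQpos : ∀ J, 0 ≤ J → J ≤ E → 0 < Q J := fun J h0 h1 =>
    hT.m_pos.trans_le (hT.amp_ge J h0 (by rwa [hcE]))
  -- the affine functions `Q ± R` are positive at both ends, since the modes are saddles
  have hRQ : ∀ J, 0 ≤ J → J ≤ E → 0 < Q J - R J ∧ 0 < Q J + R J := by
    have key : ∀ a b : ℝ, 0 < E * a → 0 < E * (a + b * E) → ∀ J, 0 ≤ J → J ≤ E →
        0 < a + b * J := by
      intro a b ha hb J h0 h1
      have ha := pos_of_mul_pos_right ha hE.le
      have hb := pos_of_mul_pos_right hb hE.le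
      rcases le_total 0 b with h | h <;> nlinarith
    have i1 := h1 .inclined
    have i2 := h2 .inclined
    have l1 := h1 .loop
    have l2 := h2 .loop
    simp only [Chart.slope, Chart.amp, Chart.amp', Family.sign, hcE, hc1] at i1 i2 l1 l2
    intro J hJ0 hJ1
    constructor
    · have := key (c.d0 - (c.c2 + c.c3 * E)) (c.d1 - c.c3) (by linarith) (by linarith) J hJ0 hJ1
      simp only [hQ, hR]; linarith
    · have := key (c.d0 + (c.c2 + c.c3 * E)) (c.d1 + c.c3) (by linarith) (by linarith) J hJ0 hJ1
      simp only [hQ, hR]; linarith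
  set s : ℝ → ℝ := fun J => √((Q J - R J) * (Q J + R J)) with hs
  have hs_cont : Continuous s := by simp only [hs, hQ, hR]; fun_prop
  have hs_pos : ∀ J, 0 ≤ J → J ≤ E → 0 < s J := fun J h0 h1 =>
    Real.sqrt_pos.2 (mul_pos (hRQ J h0 h1).1 (hRQ J h0 h1).2)
  have hσ : ∀ y, 0 < E * Real.sigmoid y ∧ E * Real.sigmoid y < E := fun y =>
    ⟨mul_pos hE (Real.sigmoid_pos y), mul_lt_of_lt_one_right hE (Real.sigmoid_lt_one y)⟩
  obtain ⟨M, hM⟩ := (isCompact_Icc (a := (0 : ℝ)) (b := E)).bddAbove_image hs_cont.continuousOn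
  obtain ⟨y, hy, hbot, htop⟩ := exists_solution_of_pos
    (f := fun y => 2 * E * s (E * Real.sigmoid y)) (M := 2 * E * M)
    ((hs_cont.comp (continuous_const.mul continuous_sigmoid)).const_mul _)
    (fun y => mul_pos (by linarith) (hs_pos _ (hσ y).1.le (hσ y).2.le))
    (fun y => mul_le_mul_of_nonneg_left
      (hM (mem_image_of_mem s ⟨(hσ y).1.le, (hσ y).2.le⟩)) (by linarith))
  set J : ℝ → ℝ := fun t => E * Real.sigmoid (y t) with hJ
  have hJmem : ∀ t, 0 < J t ∧ J t < E := fun t => hσ (y t)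
  have hJd : ∀ t, HasDerivAt J (2 * J t * (E - J t) * s (J t)) t := fun t => by
    refine (((Real.hasDerivAt_sigmoid (y t)).comp t (hy t)).const_mul E).congr_deriv ?_
    simp only [hJ]; ring
  set ψ : ℝ → ℝ := fun t => -(Real.arccos (R (J t) / Q (J t)) / 2) with hψ
  have hlt : ∀ t, -1 < R (J t) / Q (J t) ∧ R (J t) / Q (J t) < 1 := fun t => by
    have hq := hQpos _ (hJmem t).1.le (hJmem t).2.le
    have := hRQ _ (hJmem t).1.le (hJmem t).2.le
    rw [lt_div_iff₀ hq, div_lt_one hq]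
    constructor <;> linarith
  have hcos : ∀ t, Real.cos (2 * ψ t) = R (J t) / Q (J t) := fun t => by
    rw [show 2 * ψ t = -Real.arccos (R (J t) / Q (J t)) by simp only [hψ]; ring, Real.cos_neg,
      Real.cos_arccos (hlt t).1.le (hlt t).2.le]
  have hsin : ∀ t, Real.sin (2 * ψ t) = -(s (J t) / Q (J t)) := fun t => by
    have hq := hQpos _ (hJmem t).1.le (hJmem t).2.le
    rw [show 2 * ψ t = -Real.arccos (R (J t) / Q (J t)) by simp only [hψ]; ring, Real.sin_neg,
      Real.sin_arccos]
    simp only [hs]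
    rw [show 1 - (R (J t) / Q (J t)) ^ 2 = (Q (J t) - R (J t)) * (Q (J t) + R (J t)) / Q (J t) ^ 2
      by field_simp; ring, Real.sqrt_div' _ (sq_nonneg _), Real.sqrt_sq hq.le]
  have hJψ : ∀ t, c.polarψ (J t) (ψ t) = 2 * J t * (E - J t) * s (J t) := fun t => by
    have hq := (hQpos _ (hJmem t).1.le (hJmem t).2.le).ne'
    have ha : c.amp (J t) = (E - J t) * Q (J t) := by simp only [Chart.amp, hcE, hQ]
    rw [Chart.polarψ, hsin, ha]
    field_simp
  refine ⟨J, ψ, hJmem, fun t => by rw [hJψ]; exact hJd t, fun t => ?_, ?_, ?_⟩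
  · -- `ψ` is differentiable, and conservation of energy determines its derivative
    obtain ⟨D, hD⟩ : ∃ D, HasDerivAt ψ D t := by
      have hq := (hQpos _ (hJmem t).1.le (hJmem t).2.le).ne'
      have hRd := (((hJd t).add_const E).const_mul c.c3).const_add c.c2
      have hQd := ((hJd t).const_mul c.d1).const_add c.d0
      have hdiv : HasDerivAt (fun t => R (J t) / Q (J t)) _ t := hRd.div hQd hq
      have harc := (Real.hasDerivAt_arccos (hlt t).1.ne' (hlt t).2.ne).comp t hdiv
      exact ⟨_, (harc.div_const 2).neg⟩
    have hconst : (fun t => c.polar (J t) (ψ t)) = fun _ => c.c0 := by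
      funext t
      have hq := (hQpos _ (hJmem t).1.le (hJmem t).2.le).ne'
      have ha : c.amp (J t) = (E - J t) * Q (J t) := by simp only [Chart.amp, hcE, hQ]
      rw [Chart.polar, hcos, ha, Chart.radial, hc1]
      simp only [hR]
      field_simp
      ring
    have h := c.hasDerivAt_polar (hJd t) hD
    rw [hconst] at h
    have h := h.unique (hasDerivAt_const t c.c0)
    rw [hJψ] at h
    have hne : 2 * J t * (E - J t) * s (J t) ≠ 0 := by
      have := hs_pos _ (hJmem t).1.le (hJmem t).2.le
      have := (hJmem t).1
      have := sub_pos.2 (hJmem t).2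
      positivity
    have : c.polarJ (J t) (ψ t) + D = 0 :=
      (mul_eq_zero.1 (by linarith : (c.polarJ (J t) (ψ t) + D) * _ = 0)).resolve_right hne
    rwa [eq_neg_of_add_eq_zero_right this] at hD
  · simpa [hJ, Mode.action, Function.comp_def] using
      (Real.tendsto_sigmoid_atBot.comp hbot).const_mul E
  · simpa [hJ, Mode.action, Function.comp_def] using
      (Real.tendsto_sigmoid_atTop.comp htop).const_mul E

end

noncomputable section

/-! ### Threshold curves -/

/-- The coefficients of a function `δ + E (a + b δ + d E)` of detuning and energy. -/
structure Curve where
  (a b d : ℝ)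

namespace Curve

/-- The function with the coefficients `f`; its zero set is a threshold curve. -/
def eval (f : Curve) (δ E : ℝ) : ℝ := δ + E * (f.a + f.b * δ + f.d * E)

/-- The expansion to second order of the root `E` of `f.eval δ E = 0` that vanishes with `δ`. -/
def expansion (f : Curve) (δ : ℝ) : ℝ := -(δ / f.a) + (f.b * f.a - f.d) / f.a ^ 3 * δ ^ 2

theorem expansion_of_neg {f : Curve} {X N : ℝ} (ha : f.a = -2 * X)
    (hN : f.b * f.a - f.d = -N / 6) (δ : ℝ) :
    f.expansion δ = δ / (2 * X) + N * δ ^ 2 / (48 * X ^ 3) := by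
  rw [expansion, hN, ha]; ring

theorem expansion_of_pos {f : Curve} {X N : ℝ} (ha : f.a = 2 * X)
    (hN : f.b * f.a - f.d = -N / 6) (δ : ℝ) :
    f.expansion δ = -(δ / (2 * X)) - N * δ ^ 2 / (48 * X ^ 3) := by
  rw [expansion, hN, ha]; ring

/-- On the scale `r` the function increases in `E` at a rate of at least `a / 2`; here `t` stands
for the sum of two energies. -/
def Steep (f : Curve) (r : ℝ) : Prop :=
  ∀ δ t, |δ| ≤ r → |t| ≤ 2 * r → f.a / 2 ≤ f.a + f.b * δ + f.d * t

variable {f g : Curve} {r δ : ℝ}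

theorem eval_sub (f : Curve) (δ x y : ℝ) :
    f.eval δ y - f.eval δ x = (y - x) * (f.a + f.b * δ + f.d * (x + y)) := by
  simp only [eval]; ring

theorem Steep.eval_lt (h : f.Steep r) (ha : 0 < f.a) (hδ : |δ| ≤ r) {x y : ℝ} (hx : 0 ≤ x)
    (hxy : x < y) (hy : y ≤ r) : f.eval δ x < f.eval δ y := by
  have h1 := h δ (x + y) hδ (by rw [abs_of_nonneg] <;> linarith)
  have h2 := f.eval_sub δ x y
  nlinarith

/-- The root that vanishes with `δ`, as a function of `δ`. -/
theorem exists_root (f : Curve) (hr : 0 < r) (hf : 0 < f.a → f.Steep r) :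
    ∃ e : ℝ → ℝ, ∃ δ₀ > 0, 0 < f.a →
      (fun δ => e δ - f.expansion δ) =O[𝓝[≤] 0] (fun δ => δ ^ 3) ∧
      ∀ δ, -δ₀ < δ → δ < 0 → 0 < e δ ∧ e δ < r ∧ f.eval δ (e δ) = 0 := by
  by_cases ha : 0 < f.a
  swap
  · exact ⟨0, 1, one_pos, fun h => (ha h).elim⟩
  have hst := hf ha
  set δ₀ := min r (r * (f.a / 2)) with hδ₀
  have hδ₀_pos : 0 < δ₀ := lt_min hr (by positivity)
  have hex : ∀ δ, ∃ e, (-δ₀ < δ → δ < 0 → 0 < e ∧ e < r ∧ f.eval δ e = 0) ∧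
      (δ = 0 → e = 0) := by
    intro δ
    by_cases h : -δ₀ < δ ∧ δ < 0
    swap
    · exact ⟨0, fun h1 h2 => (h ⟨h1, h2⟩).elim, fun _ => rfl⟩
    obtain ⟨h1, h2⟩ := h
    have hr1 : -δ < r := by linarith [min_le_left r (r * (f.a / 2))]
    have hr2 : -δ < r * (f.a / 2) := by linarith [min_le_right r (r * (f.a / 2))]
    have hrδ := hst δ r (by rw [abs_of_neg h2]; exact hr1.le) (by rw [abs_of_pos hr]; linarith)
    have hcont : Continuous (f.eval δ) := by unfold eval; fun_prop
    have : (0 : ℝ) ∈ Ioo (f.eval δ 0) (f.eval δ r) := by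
      simp only [eval, mem_Ioo]
      constructor
      · linarith
      · nlinarith [mul_le_mul_of_nonneg_left hrδ hr.le]
    obtain ⟨e, he, he'⟩ := intermediate_value_Ioo hr.le hcont.continuousOn this
    exact ⟨e, fun _ _ => ⟨he.1, he.2, he'⟩, fun h => by linarith⟩
  choose e he he0 using hex
  refine ⟨e, δ₀, hδ₀_pos, fun _ => ⟨?_, he⟩⟩
  -- the expansion solves the equation up to third order
  have hres : (fun δ => f.eval δ (f.expansion δ)) =O[𝓝[≤] 0] (fun δ : ℝ => δ ^ 3) := by
    set κ := (f.b * f.a - f.d) / f.a ^ 3 with hκ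
    have hform : (fun δ => f.eval δ (f.expansion δ)) = fun δ =>
        δ ^ 3 * (f.b * κ - 2 * f.d * κ / f.a + f.d * κ ^ 2 * δ) := by
      funext δ
      simp only [eval, expansion, ← hκ]
      have : f.a * κ - f.b / f.a + f.d / f.a ^ 2 = 0 := by rw [hκ]; field_simp; ring
      have h2 : f.a / f.a = 1 := div_self ha.ne'
      linear_combination δ ^ 2 * this - δ * h2
    rw [hform]
    have hg : Continuous fun δ : ℝ => f.b * κ - 2 * f.d * κ / f.a + f.d * κ ^ 2 * δ := by fun_prop
    simpa using (isBigO_refl (fun δ : ℝ => δ ^ 3) (𝓝[≤] 0)).mul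
      (((hg.tendsto 0).mono_left nhdsWithin_le_nhds).isBigO_one ℝ)
  refine IsBigO.trans (IsBigO.of_bound (2 / f.a) ?_) hres
  have hcont : Continuous f.expansion := by unfold expansion; fun_prop
  have hexp0 : f.expansion 0 = 0 := by simp [expansion]
  have hsmall : ∀ᶠ δ in 𝓝[≤] (0 : ℝ), |f.expansion δ| < r := by
    refine nhdsWithin_le_nhds ?_
    exact hcont.abs.continuousAt.eventually_lt_const (by simpa [hexp0] using hr)
  filter_upwards [hsmall, nhdsWithin_le_nhds (Ioi_mem_nhds (neg_lt_zero.2 hδ₀_pos)),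
    self_mem_nhdsWithin] with δ h1 h2 h3
  rcases (show δ ≤ 0 from h3).eq_or_lt with rfl | h3
  · simp [he0 0 rfl, hexp0, eval]
  obtain ⟨p0, p1, p2⟩ := he δ h2 h3
  have hr1 : -δ < r := by linarith [min_le_left r (r * (f.a / 2)), mem_Ioi.1 h2]
  have hb := hst δ (e δ + f.expansion δ) (by rw [abs_of_neg h3]; exact hr1.le)
    ((abs_add_le _ _).trans (by rw [abs_of_pos p0]; linarith))
  have hs := f.eval_sub δ (e δ) (f.expansion δ)
  rw [p2, sub_zero] at hs
  rw [hs, Real.norm_eq_abs, Real.norm_eq_abs, abs_mul, abs_sub_comm (f.expansion δ),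
    abs_of_pos (lt_of_lt_of_le (half_pos ha) hb)]
  calc |e δ - f.expansion δ| = 2 / f.a * (|e δ - f.expansion δ| * (f.a / 2)) := by field_simp
    _ ≤ _ := by gcongr

end Curve

/-- The curve on which the slope at the mode `k` along the axis of `F` vanishes. -/
def modeCurve (v : Coeffs) : Mode → Family → Curve
  | .one, F =>
    { a := -3 * v.v04 + v.v22 * (1 + F.sign / 2)
      b := -v.v22 * (1 + F.sign / 2)
      d := -3 / 4 * (10 * v.v06 - 17 * v.v04 ^ 2)
        + 1 / 4 * (6 * v.v24 - 9 / 4 * v.v22 ^ 2 - 12 * v.v22 * v.v04)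
        + F.sign * (1 / 4 * (4 * v.v24 - 2 * v.v22 ^ 2 - 5 * v.v22 * v.v04)) }
  | .two, F =>
    { a := 3 * v.v40 - v.v22 * (1 + F.sign / 2)
      b := -6 * v.v40 + v.v22 * (1 + F.sign / 2)
      d := 3 / 4 * (10 * v.v60 - 17 * v.v40 ^ 2)
        - 1 / 4 * (6 * v.v42 - 9 / 4 * v.v22 ^ 2 - 12 * v.v22 * v.v40)
        - F.sign * (1 / 4 * (4 * v.v42 - 2 * v.v22 ^ 2 - 5 * v.v22 * v.v40)) }

/-- The curve on which the two modes lie on the same level of the Hamiltonian. -/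
def gapCurve (v : Coeffs) : Curve where
  a := 2 * v.B
  b := -3 * v.v40
  d := 1 / 4 * (10 * v.v60 - 17 * v.v40 ^ 2) - 1 / 4 * (10 * v.v06 - 17 * v.v04 ^ 2)

variable (v : Coeffs)

theorem modeSlope_one_inclined (δ E : ℝ) :
    modeSlope v δ E .one .inclined = (modeCurve v .one .inclined).eval δ E := by
  simp only [modeSlope_eq, chart, modeCurve, Curve.eval, Family.sign]; ring

theorem modeSlope_one_loop (δ E : ℝ) :
    modeSlope v δ E .one .loop = -(modeCurve v .one .loop).eval δ E := by
  simp only [modeSlope_eq, chart, modeCurve, Curve.eval, Family.sign]; ring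

theorem modeSlope_two_inclined (δ E : ℝ) :
    modeSlope v δ E .two .inclined = -(modeCurve v .two .inclined).eval δ E := by
  simp only [modeSlope_eq, chart, modeCurve, Curve.eval, Family.sign]; ring

theorem modeSlope_two_loop (δ E : ℝ) :
    modeSlope v δ E .two .loop = (modeCurve v .two .loop).eval δ E := by
  simp only [modeSlope_eq, chart, modeCurve, Curve.eval, Family.sign]; ring

theorem gap_eq (δ E : ℝ) : (chart v δ E .one).gap = (gapCurve v).eval δ E := by
  simp only [Chart.gap, chart, gapCurve, Curve.eval, Coeffs.B]; ring

theorem modeCurve_one_inclined_a :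
    (modeCurve v .one .inclined).a = -2 * (2 * v.A - v.B - 6 * v.C) := by
  simp only [modeCurve, Family.sign, Coeffs.A, Coeffs.B, Coeffs.C]; ring

theorem modeCurve_one_loop_a :
    (modeCurve v .one .loop).a = -2 * (2 * v.A - v.B - 2 * v.C) := by
  simp only [modeCurve, Family.sign, Coeffs.A, Coeffs.B, Coeffs.C]; ring

theorem modeCurve_two_inclined_a :
    (modeCurve v .two .inclined).a = 2 * (2 * v.A + v.B - 6 * v.C) := by
  simp only [modeCurve, Family.sign, Coeffs.A, Coeffs.B, Coeffs.C]; ring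

theorem modeCurve_two_loop_a :
    (modeCurve v .two .loop).a = 2 * (2 * v.A + v.B - 2 * v.C) := by
  simp only [modeCurve, Family.sign, Coeffs.A, Coeffs.B, Coeffs.C]; ring

theorem expansion_one_inclined (δ : ℝ) :
    (modeCurve v .one .inclined).expansion δ = expansion1I v δ :=
  Curve.expansion_of_neg (modeCurve_one_inclined_a v) (by
    simp only [modeCurve, Family.sign, Coeffs.A, Coeffs.B, Coeffs.C]; ring) δ

theorem expansion_one_loop (δ : ℝ) :
    (modeCurve v .one .loop).expansion δ = expansion1L v δ :=
  Curve.expansion_of_neg (modeCurve_one_loop_a v) (by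
    simp only [modeCurve, Family.sign, Coeffs.A, Coeffs.B, Coeffs.C]; ring) δ

theorem expansion_two_inclined (δ : ℝ) :
    (modeCurve v .two .inclined).expansion δ = expansion2I v δ :=
  Curve.expansion_of_pos (modeCurve_two_inclined_a v) (by
    simp only [modeCurve, Family.sign, Coeffs.A, Coeffs.B, Coeffs.C]; ring) δ

theorem expansion_two_loop (δ : ℝ) :
    (modeCurve v .two .loop).expansion δ = expansion2L v δ :=
  Curve.expansion_of_pos (modeCurve_two_loop_a v) (by
    simp only [modeCurve, Family.sign, Coeffs.A, Coeffs.B, Coeffs.C]; ring) δ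

/-- The five threshold curves. -/
def curves : Set Curve :=
  {modeCurve v .one .inclined, modeCurve v .one .loop, modeCurve v .two .inclined,
    modeCurve v .two .loop, gapCurve v}

theorem modeCurve_mem (k : Mode) (F : Family) : modeCurve v k F ∈ curves v := by
  cases k <;> cases F <;> simp [curves]

theorem gapCurve_mem : gapCurve v ∈ curves v := by simp [curves]

/-! ### The regime of small energy and detuning -/

/-- The scale `r` is so small that the signs of all relevant quantities are those of their leading
parts. -/
structure Regime (m r : ℝ) : Prop where
  r_pos : 0 < r
  tame : ∀ δ E, |δ| ≤ r → 0 < E → E ≤ r → ∀ k, (chart v δ E k).Tame m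
  steep : ∀ f ∈ curves v, 0 < f.a → f.Steep r
  compare : ∀ f ∈ curves v, ∀ g ∈ curves v, f.a < g.a →
    ∀ δ E, |δ| ≤ r → 0 < E → E ≤ r → f.eval δ E < g.eval δ E

theorem eventually_lt_on_box {g : ℝ → ℝ → ℝ → ℝ} {c : ℝ}
    (hg : Continuous fun x : ℝ × ℝ × ℝ => g x.1 x.2.1 x.2.2) (h : c < g 0 0 0) :
    ∀ᶠ r in 𝓝[>] (0 : ℝ), ∀ δ E t, |δ| ≤ r → |E| ≤ r → |t| ≤ 2 * r → c < g δ E t := by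
  have h0 : ∀ᶠ x : ℝ × ℝ × ℝ in 𝓝 0, c < g x.1 x.2.1 x.2.2 :=
    hg.continuousAt.eventually_const_lt h
  obtain ⟨ε, hε, H⟩ := Metric.eventually_nhds_iff.1 h0
  filter_upwards [Ioo_mem_nhdsGT (half_pos hε)] with r hr δ E t h1 h2 h3
  have hr1 := hr.1
  have hr2 := hr.2
  refine @H (δ, E, t) ?_
  rw [dist_zero_right, Prod.norm_mk, Prod.norm_mk, max_lt_iff, max_lt_iff]
  simp only [Real.norm_eq_abs]
  exact ⟨by linarith, by linarith, by linarith⟩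

theorem exists_regime (hA3C : v.A - 3 * v.C < 0) (hAC : 0 < v.A - v.C) :
    ∃ m r, Regime v m r := by
  have hC : 0 < v.C := by linarith
  obtain ⟨m, hm, hm1, hm2, hm3⟩ : ∃ m > 0, m < 4 * v.C ∧ m < 8 * (3 * v.C - v.A) ∧
      m < 8 * (v.A - v.C) := by
    obtain ⟨m, h0, h1⟩ := exists_between (show (0 : ℝ) < min (4 * v.C)
      (min (8 * (3 * v.C - v.A)) (8 * (v.A - v.C))) from
        lt_min (by linarith) (lt_min (by linarith) (by linarith)))
    exact ⟨m, h0, lt_min_iff.1 h1 |>.1, (lt_min_iff.1 (lt_min_iff.1 h1).2).1,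
      (lt_min_iff.1 (lt_min_iff.1 h1).2).2⟩
  have hamp : ∀ k, ∀ᶠ r in 𝓝[>] (0 : ℝ), ∀ δ E t, |δ| ≤ r → |E| ≤ r → |t| ≤ 2 * r →
      m < (chart v δ E k).d0 + (chart v δ E k).d1 * t := by
    intro k
    refine eventually_lt_on_box (g := fun δ E t =>
      (chart v δ E k).d0 + (chart v δ E k).d1 * t) ?_ ?_
    · cases k <;> simp only [chart] <;> fun_prop
    · refine hm1.trans_eq ?_
      cases k <;> simp only [chart, Coeffs.C] <;> ring
  have hquot : ∀ k F, ∀ᶠ r in 𝓝[>] (0 : ℝ), ∀ δ E t, |δ| ≤ r → |E| ≤ r → |t| ≤ 2 * r →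
      m < -(chart v δ E k).slopeQuot F t := by
    intro k F
    refine eventually_lt_on_box (g := fun δ E t => -(chart v δ E k).slopeQuot F t) ?_ ?_
    · cases k <;> simp only [chart, Chart.slopeQuot] <;> fun_prop
    · cases F
      · refine hm2.trans_eq ?_
        cases k <;> simp only [chart, Chart.slopeQuot, Family.sign, Coeffs.C, Coeffs.A] <;> ring
      · refine hm3.trans_eq ?_
        cases k <;> simp only [chart, Chart.slopeQuot, Family.sign, Coeffs.C, Coeffs.A] <;> ring
  have hfin : (curves v).Finite := by unfold curves; exact Set.toFinite _
  have hsteep : ∀ᶠ r in 𝓝[>] (0 : ℝ), ∀ f ∈ curves v, 0 < f.a → f.Steep r := by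
    refine hfin.eventually_all.2 fun f _ => ?_
    by_cases ha : 0 < f.a
    swap
    · exact Eventually.of_forall fun r h => (ha h).elim
    filter_upwards [self_mem_nhdsWithin, eventually_lt_on_box (c := f.a / 2)
      (g := fun δ _ t => f.a + f.b * δ + f.d * t) (by fun_prop) (by linarith)]
      with r hr h _ δ t hδ ht
    exact (h δ 0 t hδ (by simpa using (mem_Ioi.1 hr).le) ht).le
  have hcomp : ∀ᶠ r in 𝓝[>] (0 : ℝ), ∀ f ∈ curves v, ∀ g ∈ curves v, f.a < g.a →
      ∀ δ E, |δ| ≤ r → 0 < E → E ≤ r → f.eval δ E < g.eval δ E := by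
    refine hfin.eventually_all.2 fun f _ => hfin.eventually_all.2 fun g _ => ?_
    by_cases ha : f.a < g.a
    swap
    · exact Eventually.of_forall fun r h => (ha h).elim
    filter_upwards [self_mem_nhdsWithin, eventually_lt_on_box (c := 0)
      (g := fun δ E _ => (g.a - f.a) + (g.b - f.b) * δ + (g.d - f.d) * E) (by fun_prop)
      (by linarith)] with r hr h _ δ E hδ hE hEr
    have := mul_pos hE (h δ E 0 hδ (by rwa [abs_of_pos hE])
      (by simpa using (mem_Ioi.1 hr).le))
    simp only [Curve.eval]
    linarith
  obtain ⟨r, hr, a1, a2, q1, q2, q3, q4, hs, hc⟩ := (eventually_mem_nhdsWithin.and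
    ((hamp .one).and ((hamp .two).and ((hquot .one .inclined).and ((hquot .one .loop).and
      ((hquot .two .inclined).and ((hquot .two .loop).and (hsteep.and hcomp)))))))).exists
  refine ⟨m, r, hr, fun δ E hδ hE hEr k => ⟨hm, by rwa [chart_E], ?_, ?_⟩, hs, hc⟩
  · rw [chart_E]
    intro p hp hpE
    have h1 : |E| ≤ r := by rwa [abs_of_pos hE]
    have h2 : |p| ≤ 2 * r := by rw [abs_of_nonneg hp]; linarith
    cases k
    exacts [(a1 δ E p hδ h1 h2).le, (a2 δ E p hδ h1 h2).le]
  · rw [chart_E]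
    intro F t ht htE
    have h1 : |E| ≤ r := by rwa [abs_of_pos hE]
    have h2 : |t| ≤ 2 * r := by rw [abs_of_nonneg ht]; linarith
    cases k <;> cases F
    exacts [by linarith [q1 δ E t hδ h1 h2], by linarith [q2 δ E t hδ h1 h2],
      by linarith [q3 δ E t hδ h1 h2], by linarith [q4 δ E t hδ h1 h2]]

namespace Regime

variable {v} {m r δ e : ℝ} (H : Regime v m r)
include H

/-- Of two threshold curves the one with the larger coefficient `a` is reached first. -/
theorem root_lt_root {f g : Curve} (hf : f ∈ curves v) (hg : g ∈ curves v) (ha : 0 < f.a)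
    (hfg : f.a < g.a) (hδ : |δ| ≤ r) {x y : ℝ} (hx : 0 < x) (hxr : x < r)
    (hgx : g.eval δ x = 0) (hy : 0 < y) (hfy : f.eval δ y = 0) : x < y := by
  by_contra! hyx
  have h1 := H.compare f hf g hg hfg δ x hδ hx hxr.le
  rcases hyx.eq_or_lt with rfl | hyx
  · linarith
  · linarith [(H.steep f hf ha).eval_lt ha hδ hy.le hyx hxr.le]

theorem eventually_tame (hδ : |δ| ≤ r) (he : 0 < e) (her : e < r) (k : Mode) :
    ∀ᶠ E in 𝓝 e, (chart v δ E k).Tame m := by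
  filter_upwards [Ioo_mem_nhds he her] with E hE using H.tame δ E hδ hE.1 hE.2.le k

theorem eventually_eval_neg {f : Curve} (hf : f ∈ curves v) (ha : 0 < f.a) (hδ : |δ| ≤ r)
    (he : 0 < e) (her : e < r) (h0 : f.eval δ e = 0) : ∀ᶠ E in 𝓝[<] e, f.eval δ E < 0 := by
  filter_upwards [Ioo_mem_nhdsLT he] with E hE
  rw [← h0]
  exact (H.steep f hf ha).eval_lt ha hδ hE.1.le hE.2 her.le

theorem eventually_eval_pos {f : Curve} (hf : f ∈ curves v) (ha : 0 < f.a) (hδ : |δ| ≤ r)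
    (he : 0 < e) (her : e < r) (h0 : f.eval δ e = 0) : ∀ᶠ E in 𝓝[>] e, 0 < f.eval δ E := by
  filter_upwards [Ioo_mem_nhdsGT her] with E hE
  rw [← h0]
  exact (H.steep f hf ha).eval_lt ha hδ he.le hE.1 hE.2.le

theorem eval_ne_zero {f : Curve} (hf : f ∈ curves v) (ha : 0 < f.a) (hδ : |δ| ≤ r)
    (he : 0 < e) (her : e < r) (h0 : f.eval δ e = 0) {E : ℝ} (hE : 0 < E) (hEr : E < r)
    (hne : E ≠ e) : f.eval δ E ≠ 0 := by
  rw [← h0]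
  rcases hne.lt_or_gt with h | h
  · exact ((H.steep f hf ha).eval_lt ha hδ hE.le h her.le).ne
  · exact ((H.steep f hf ha).eval_lt ha hδ he.le h hEr.le).ne'

theorem occursAt_appears {k : Mode} {F : Family}
    (hs : ∀ E, modeSlope v δ E k F = (modeCurve v k F).eval δ E) (ha : 0 < (modeCurve v k F).a)
    (hδ : |δ| ≤ r) (he : 0 < e ∧ e < r ∧ (modeCurve v k F).eval δ e = 0) :
    OccursAt v δ e (.appears k F) := by
  obtain ⟨h0, hr, h⟩ := he
  refine stablePairBranches_of_modeSlope nhdsWithin_le_nhds nhdsWithin_le_nhds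
    (H.eventually_tame hδ h0 hr k) ((hs e).trans h) ?_ ?_
  · simpa only [hs] using H.eventually_eval_neg (modeCurve_mem v k F) ha hδ h0 hr h
  · simpa only [hs] using H.eventually_eval_pos (modeCurve_mem v k F) ha hδ h0 hr h

theorem occursAt_disappears {k : Mode} {F : Family}
    (hs : ∀ E, modeSlope v δ E k F = -(modeCurve v k F).eval δ E) (ha : 0 < (modeCurve v k F).a)
    (hδ : |δ| ≤ r) (he : 0 < e ∧ e < r ∧ (modeCurve v k F).eval δ e = 0) :
    OccursAt v δ e (.disappears k F) := by
  obtain ⟨h0, hr, h⟩ := he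
  refine stablePairBranches_of_modeSlope nhdsWithin_le_nhds nhdsWithin_le_nhds
    (H.eventually_tame hδ h0 hr k) ((hs e).trans (by rw [h, neg_zero])) ?_ ?_
  · simpa only [hs, neg_lt_zero] using
      H.eventually_eval_pos (modeCurve_mem v k F) ha hδ h0 hr h
  · simpa only [hs, neg_pos] using
      H.eventually_eval_neg (modeCurve_mem v k F) ha hδ h0 hr h

theorem occursAt_connection (hA3C : v.A - 3 * v.C < 0) (hAC : 0 < v.A - v.C)
    (ha : 0 < (gapCurve v).a) (hδ : |δ| ≤ r)
    (he : 0 < e ∧ e < r ∧ (gapCurve v).eval δ e = 0) : OccursAt v δ e .connection := by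
  obtain ⟨h0, hr, h⟩ := he
  have hg : (gapCurve v).a = 2 * v.B := rfl
  have hpos : ∀ k F, 0 < modeSlope v δ e k F := by
    intro k F
    have hup := H.compare _ (gapCurve_mem v) _ (modeCurve_mem v k F)
    have hdn := H.compare _ (modeCurve_mem v k F) _ (gapCurve_mem v)
    cases k <;> cases F
    · rw [modeSlope_one_inclined, ← h]
      exact hup (by rw [modeCurve_one_inclined_a, hg]; linarith) δ e hδ h0 hr.le
    · rw [modeSlope_one_loop, neg_pos, ← h]
      exact hdn (by rw [modeCurve_one_loop_a, hg]; linarith) δ e hδ h0 hr.le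
    · rw [modeSlope_two_inclined, neg_pos, ← h]
      exact hdn (by rw [modeCurve_two_inclined_a, hg]; linarith) δ e hδ h0 hr.le
    · rw [modeSlope_two_loop, ← h]
      exact hup (by rw [modeCurve_two_loop_a, hg]; linarith) δ e hδ h0 hr.le
  have hconn := hasConnection_of_gap_eq_zero (H.tame δ e hδ h0 hr.le .one)
    ((gap_eq v δ e).trans h) hpos
  refine ⟨(modeSaddle_iff v δ e .one).2 (mul_pos (hpos _ _) (hpos _ _)),
    (modeSaddle_iff v δ e .two).2 (mul_pos (hpos _ _) (hpos _ _)), hconn, hconn.symm,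
    eventually_sameNature (H.eventually_tame hδ h0 hr .one) fun k F => (hpos k F).ne', ?_⟩
  filter_upwards [self_mem_nhdsWithin, nhdsWithin_le_nhds (Ioo_mem_nhds h0 hr)] with E hne hE
  have := H.eval_ne_zero (gapCurve_mem v) ha hδ h0 hr h hE.1 hE.2 hne
  rw [← gap_eq] at this
  exact ⟨fun hc => this (hc.gap_eq_zero hE.1), fun hc => this (hc.symm.gap_eq_zero hE.1)⟩

theorem isRegularEnergy {E : ℝ} (hδ : |δ| ≤ r) (hE : 0 < E) (hEr : E < r)
    (h : ∀ f ∈ curves v, f.eval δ E ≠ 0) : IsRegularEnergy v δ E := by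
  have hgap := h _ (gapCurve_mem v)
  rw [← gap_eq] at hgap
  refine ⟨eventually_sameNature (H.eventually_tame hδ hE hEr .one) fun k F => ?_,
    fun hc => hgap (hc.gap_eq_zero hE), fun hc => hgap (hc.symm.gap_eq_zero hE)⟩
  have := h _ (modeCurve_mem v k F)
  cases k <;> cases F
  · rwa [modeSlope_one_inclined]
  · rwa [modeSlope_one_loop, neg_ne_zero]
  · rwa [modeSlope_two_inclined, neg_ne_zero]
  · rwa [modeSlope_two_loop]

theorem isRegularEnergy_zero {E : ℝ} (hE : 0 < E) (hEr : E < r)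
    (ha : ∀ f ∈ curves v, 0 < f.a) : IsRegularEnergy v 0 E := by
  refine H.isRegularEnergy (by simpa using H.r_pos.le) hE hEr fun f hf => ?_
  have := H.steep f hf (ha f hf) 0 E (by simpa using H.r_pos.le)
    (by rw [abs_of_pos hE]; linarith)
  have := ha f hf
  simp only [Curve.eval, zero_add]
  exact mul_ne_zero hE.ne' (by linarith)

end Regime

end

end Resonance22

/-! ### The bifurcation sequences -/

theorem proposition7 (v : Coeffs)
    (hC : v.C ≠ 0) (hA3C : v.A - 3 * v.C < 0) (hAC : 0 < v.A - v.C) :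
    -- the threshold curves `E = e (δ)`
    ∃ e1I e1L e2I e2L eGB : ℝ → ℝ,
      (2 * (v.A - 3 * v.C) < v.B →
        (fun δ => e1I δ - expansion1I v δ) =O[𝓝[≤] 0] (fun δ => δ ^ 3)) ∧
      (2 * (v.A - v.C) < v.B →
        (fun δ => e1L δ - expansion1L v δ) =O[𝓝[≤] 0] (fun δ => δ ^ 3)) ∧
      (2 * (3 * v.C - v.A) < v.B →
        (fun δ => e2I δ - expansion2I v δ) =O[𝓝[≤] 0] (fun δ => δ ^ 3)) ∧
      (2 * (v.C - v.A) < v.B →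
        (fun δ => e2L δ - expansion2L v δ) =O[𝓝[≤] 0] (fun δ => δ ^ 3)) ∧
      (0 < v.B →
        (fun δ => eGB δ - -(δ / (2 * v.B))) =O[𝓝[≤] 0] (fun δ => δ ^ 2)) ∧
      ∃ r > 0, ∃ δ₀ > 0,
        (∀ δ, -δ₀ < δ → δ < 0 →
          (v.A - 2 * v.C < 0 →
            IsBifurcationSequence v δ r
              [⟨2 * (v.A - 3 * v.C) < v.B, e1I δ, .appears .one .inclined⟩,
               ⟨2 * (v.C - v.A) < v.B, e2L δ, .appears .two .loop⟩,
               ⟨0 < v.B, eGB δ, .connection⟩,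
               ⟨2 * (v.A - v.C) < v.B, e1L δ, .disappears .one .loop⟩,
               ⟨2 * (3 * v.C - v.A) < v.B, e2I δ, .disappears .two .inclined⟩]) ∧
          (0 < v.A - 2 * v.C →
            IsBifurcationSequence v δ r
              [⟨2 * (v.C - v.A) < v.B, e2L δ, .appears .two .loop⟩,
               ⟨2 * (v.A - 3 * v.C) < v.B, e1I δ, .appears .one .inclined⟩,
               ⟨0 < v.B, eGB δ, .connection⟩,
               ⟨2 * (3 * v.C - v.A) < v.B, e2I δ, .disappears .two .inclined⟩,
               ⟨2 * (v.A - v.C) < v.B, e1L δ, .disappears .one .loop⟩])) ∧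
        -- at zero detuning all thresholds sit at `E = 0`
        (2 * (v.A - 3 * v.C) < v.B → 2 * (v.A - v.C) < v.B →
          2 * (3 * v.C - v.A) < v.B → 2 * (v.C - v.A) < v.B →
          ∀ E, 0 < E → E < r → IsRegularEnergy v 0 E) := by
  obtain ⟨m, r, H⟩ := exists_regime v hA3C hAC
  have root : ∀ f ∈ curves v, _ := fun f hf => f.exists_root H.r_pos (H.steep f hf)
  obtain ⟨e1I, d1I, hd1I, h1I⟩ := root _ (modeCurve_mem v .one .inclined)
  obtain ⟨e1L, d1L, hd1L, h1L⟩ := root _ (modeCurve_mem v .one .loop)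
  obtain ⟨e2I, d2I, hd2I, h2I⟩ := root _ (modeCurve_mem v .two .inclined)
  obtain ⟨e2L, d2L, hd2L, h2L⟩ := root _ (modeCurve_mem v .two .loop)
  obtain ⟨eGB, dGB, hdGB, hGB⟩ := root _ (gapCurve_mem v)
  have m1I := modeCurve_mem v .one .inclined
  have m1L := modeCurve_mem v .one .loop
  have m2I := modeCurve_mem v .two .inclined
  have m2L := modeCurve_mem v .two .loop
  have mGB := gapCurve_mem v
  have a1I := modeCurve_one_inclined_a v
  have a1L := modeCurve_one_loop_a v
  have a2I := modeCurve_two_inclined_a v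
  have a2L := modeCurve_two_loop_a v
  have aGB : (gapCurve v).a = 2 * v.B := rfl
  have p1I : 2 * (v.A - 3 * v.C) < v.B → 0 < (modeCurve v .one .inclined).a := fun h => by
    rw [a1I]; linarith
  have p1L : 2 * (v.A - v.C) < v.B → 0 < (modeCurve v .one .loop).a := fun h => by
    rw [a1L]; linarith
  have p2I : 2 * (3 * v.C - v.A) < v.B → 0 < (modeCurve v .two .inclined).a := fun h => by
    rw [a2I]; linarith
  have p2L : 2 * (v.C - v.A) < v.B → 0 < (modeCurve v .two .loop).a := fun h => by
    rw [a2L]; linarith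
  have pGB : 0 < v.B → 0 < (gapCurve v).a := fun h => by
    rw [aGB]; linarith
  have all_pos : 2 * (v.A - 3 * v.C) < v.B → 2 * (v.A - v.C) < v.B →
      2 * (3 * v.C - v.A) < v.B → 2 * (v.C - v.A) < v.B → ∀ f ∈ curves v, 0 < f.a := by
    rintro c1 c2 c3 c4 f (rfl | rfl | rfl | rfl | rfl)
    -- `0 < B` follows from `0 < 2 (A - C) < B`
    exacts [p1I c1, p1L c2, p2I c3, p2L c4, pGB (by linarith)]
  refine ⟨e1I, e1L, e2I, e2L, eGB, fun h => ?_, fun h => ?_, fun h => ?_, fun h => ?_,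
    fun h => ?_, r, H.r_pos, min r (min d1I (min d1L (min d2I (min d2L dGB)))), ?_, ?_, ?_⟩
  · simpa only [expansion_one_inclined] using (h1I (p1I h)).1
  · simpa only [expansion_one_loop] using (h1L (p1L h)).1
  · simpa only [expansion_two_inclined] using (h2I (p2I h)).1
  · simpa only [expansion_two_loop] using (h2L (p2L h)).1
  · have h32 : (fun δ : ℝ => δ ^ 3) =O[𝓝[≤] 0] fun δ : ℝ => δ ^ 2 :=
      (isLittleO_pow_pow (by norm_num)).isBigO.mono nhdsWithin_le_nhds
    have h2 := (isBigO_refl (fun δ : ℝ => δ ^ 2) (𝓝[≤] 0)).const_mul_left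
      (((gapCurve v).b * (gapCurve v).a - (gapCurve v).d) / (gapCurve v).a ^ 3)
    refine (((hGB (pGB h)).1.trans h32).add h2).congr_left fun δ => ?_
    simp only [Curve.expansion, aGB]; ring
  · exact lt_min H.r_pos (lt_min hd1I (lt_min hd1L (lt_min hd2I (lt_min hd2L hdGB))))
  · intro δ hδ hδ0
    obtain ⟨b0, b1, b2, b3, b4, b5⟩ : -r < δ ∧ -d1I < δ ∧ -d1L < δ ∧ -d2I < δ ∧ -d2L < δ ∧
        -dGB < δ := by
      have := neg_lt.1 hδ
      simp only [lt_min_iff] at this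
      exact ⟨neg_lt.1 this.1, neg_lt.1 this.2.1, neg_lt.1 this.2.2.1, neg_lt.1 this.2.2.2.1,
        neg_lt.1 this.2.2.2.2.1, neg_lt.1 this.2.2.2.2.2⟩
    have hδr : |δ| ≤ r := by rw [abs_of_neg hδ0]; linarith
    replace h1I := fun h => (h1I (p1I h)).2 δ b1 hδ0
    replace h1L := fun h => (h1L (p1L h)).2 δ b2 hδ0
    replace h2I := fun h => (h2I (p2I h)).2 δ b3 hδ0
    replace h2L := fun h => (h2L (p2L h)).2 δ b4 hδ0
    replace hGB := fun h => (hGB (pGB h)).2 δ b5 hδ0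
    have o1I := fun h => H.occursAt_appears (modeSlope_one_inclined v δ) (p1I h) hδr (h1I h)
    have o1L := fun h => H.occursAt_disappears (modeSlope_one_loop v δ) (p1L h) hδr (h1L h)
    have o2I := fun h => H.occursAt_disappears (modeSlope_two_inclined v δ) (p2I h) hδr (h2I h)
    have o2L := fun h => H.occursAt_appears (modeSlope_two_loop v δ) (p2L h) hδr (h2L h)
    have oGB := fun h => H.occursAt_connection hA3C hAC (pGB h) hδr (hGB h)
    have lt : ∀ {f g : Curve} {x y : ℝ}, f ∈ curves v → g ∈ curves v → 0 < f.a → f.a < g.a →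
        (0 < x ∧ x < r ∧ g.eval δ x = 0) → (0 < y ∧ y < r ∧ f.eval δ y = 0) → x < y :=
      fun hf hg ha hfg hx hy =>
        H.root_lt_root hf hg ha hfg hδr hx.1 hx.2.1 hx.2.2 hy.1 hy.2.2
    have reg : 2 * (v.A - 3 * v.C) < v.B → 2 * (v.A - v.C) < v.B →
        2 * (3 * v.C - v.A) < v.B → 2 * (v.C - v.A) < v.B → 0 < v.B → ∀ E, 0 < E → E < r →
        E ≠ e1I δ → E ≠ e1L δ → E ≠ e2I δ → E ≠ e2L δ → E ≠ eGB δ →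
        IsRegularEnergy v δ E := by
      intro c1 c2 c3 c4 c5 E hE hEr n1 n2 n3 n4 n5
      have ne : ∀ {f : Curve} {e : ℝ}, f ∈ curves v → 0 < f.a →
          (0 < e ∧ e < r ∧ f.eval δ e = 0) → E ≠ e → f.eval δ E ≠ 0 := fun hf ha he =>
        H.eval_ne_zero hf ha hδr he.1 he.2.1 he.2.2 hE hEr
      refine H.isRegularEnergy hδr hE hEr ?_
      rintro f (rfl | rfl | rfl | rfl | rfl)
      exacts [ne m1I (p1I c1) (h1I c1) n1, ne m1L (p1L c2) (h1L c2) n2,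
        ne m2I (p2I c3) (h2I c3) n3, ne m2L (p2L c4) (h2L c4) n4, ne mGB (pGB c5) (hGB c5) n5]
    refine ⟨fun h2C => ⟨?_, ?_, ?_⟩, fun h2C => ⟨?_, ?_, ?_⟩⟩
    · simp only [List.forall_mem_cons, List.not_mem_nil, false_imp_iff, implies_true, and_true]
      exact ⟨fun h => ⟨(h1I h).1, (h1I h).2.1, o1I h⟩, fun h => ⟨(h2L h).1, (h2L h).2.1, o2L h⟩,
        fun h => ⟨(hGB h).1, (hGB h).2.1, oGB h⟩, fun h => ⟨(h1L h).1, (h1L h).2.1, o1L h⟩,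
        fun h => ⟨(h2I h).1, (h2I h).2.1, o2I h⟩⟩
    · simp only [List.pairwise_cons, List.forall_mem_cons, List.not_mem_nil, false_imp_iff,
        implies_true, and_true, List.Pairwise.nil]
      exact ⟨⟨fun h k => lt m2L m1I (p2L k) (by linarith) (h1I h) (h2L k),
          fun h k => lt mGB m1I (pGB k) (by linarith) (h1I h) (hGB k),
          fun h k => lt m1L m1I (p1L k) (by linarith) (h1I h) (h1L k),
          fun h k => lt m2I m1I (p2I k) (by linarith) (h1I h) (h2I k)⟩,
        ⟨fun h k => lt mGB m2L (pGB k) (by linarith) (h2L h) (hGB k),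
          fun h k => lt m1L m2L (p1L k) (by linarith) (h2L h) (h1L k),
          fun h k => lt m2I m2L (p2I k) (by linarith) (h2L h) (h2I k)⟩,
        ⟨fun h k => lt m1L mGB (p1L k) (by linarith) (hGB h) (h1L k),
          fun h k => lt m2I mGB (p2I k) (by linarith) (hGB h) (h2I k)⟩,
        fun h k => lt m2I m1L (p2I k) (by linarith) (h1L h) (h2I k)⟩
    · simp only [List.forall_mem_cons, List.exists_mem_cons_iff, List.not_mem_nil, false_imp_iff,
        implies_true, and_true, false_and, exists_false, or_false]
      rintro ⟨c1, c4, c5, c2, c3⟩ E hE hEr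
      by_contra! hne
      exact hne.1 (reg c1 c2 c3 c4 c5 E hE hEr hne.2.1 hne.2.2.2.2.1 hne.2.2.2.2.2 hne.2.2.1
        hne.2.2.2.1)
    · simp only [List.forall_mem_cons, List.not_mem_nil, false_imp_iff, implies_true, and_true]
      exact ⟨fun h => ⟨(h2L h).1, (h2L h).2.1, o2L h⟩, fun h => ⟨(h1I h).1, (h1I h).2.1, o1I h⟩,
        fun h => ⟨(hGB h).1, (hGB h).2.1, oGB h⟩, fun h => ⟨(h2I h).1, (h2I h).2.1, o2I h⟩,
        fun h => ⟨(h1L h).1, (h1L h).2.1, o1L h⟩⟩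
    · simp only [List.pairwise_cons, List.forall_mem_cons, List.not_mem_nil, false_imp_iff,
        implies_true, and_true, List.Pairwise.nil]
      exact ⟨⟨fun h k => lt m1I m2L (p1I k) (by linarith) (h2L h) (h1I k),
          fun h k => lt mGB m2L (pGB k) (by linarith) (h2L h) (hGB k),
          fun h k => lt m2I m2L (p2I k) (by linarith) (h2L h) (h2I k),
          fun h k => lt m1L m2L (p1L k) (by linarith) (h2L h) (h1L k)⟩,
        ⟨fun h k => lt mGB m1I (pGB k) (by linarith) (h1I h) (hGB k),
          fun h k => lt m2I m1I (p2I k) (by linarith) (h1I h) (h2I k),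
          fun h k => lt m1L m1I (p1L k) (by linarith) (h1I h) (h1L k)⟩,
        ⟨fun h k => lt m2I mGB (p2I k) (by linarith) (hGB h) (h2I k),
          fun h k => lt m1L mGB (p1L k) (by linarith) (hGB h) (h1L k)⟩,
        fun h k => lt m1L m2I (p1L k) (by linarith) (h2I h) (h1L k)⟩
    · simp only [List.forall_mem_cons, List.exists_mem_cons_iff, List.not_mem_nil, false_imp_iff,
        implies_true, and_true, false_and, exists_false, or_false]
      rintro ⟨c4, c1, c5, c3, c2⟩ E hE hEr
      by_contra! hne
      exact hne.1 (reg c1 c2 c3 c4 c5 E hE hEr hne.2.2.1 hne.2.2.2.2.2 hne.2.2.2.2.1 hne.2.1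
        hne.2.2.2.1)
  · exact fun c1 c2 c3 c4 E hE hEr => H.isRegularEnergy_zero hE hEr (all_pos c1 c2 c3 c4)
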